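/- Computations are performed by deterministic multi-stack Turing machines with binary input and output. A 3-CNF formula is a list of clauses, each a disjunction of three not necessarily distinct literals; its size is its number of variables plus its number of clauses. The Exponential Time Hypothesis (ETH) states that there is no deterministic algorithm deciding 3-SAT in time $2^{o(s)}$ on formulas of size $s$. In Max Induced Path one is given a finite simple graph $G$ and seeks a largest vertex set $S$ such that the induced subgraph $G[S]$ is a path. For $r:\mathbb N\to[1,\infty)$, an $r$-approximation for Max Induced Path is a deterministic algorithm that, given the adjacency matrix of any graph $G$ on $n$ vertices, outputs a vertex set $S$ such that $G[S]$ is a path and $|T|\le r(n)\,|S|$ for every vertex set $T$ for which $G[T]$ is a path. **Theorem.** Assume the ETH. Let $\varepsilon>0$ and let $r:\mathbb N\to[1,\infty)$ be a function such that $r(n)\le n^{1-\varepsilon}$ for all sufficiently large $n$, such that $\lfloor r(n)\rfloor$ can be computed (in unary) in time polynomial in $n$, and such that for some constant $C$ one has $r(n)\le C\,r(n+1)$ for all $n$ (for instance, $r$ is nondecreasing). Then no $r$-approximation for Max Induced Path runs in time $2^{o(n/r(n))}$ on graphs with $n$ vertices; that is, there are no $r$-approximation for Max Induced Path and no function $g:\mathbb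 N\to\mathbb R$ with $g(n)=o(n/r(n))$ as $n\to\infty$ such that the algorithm takes at most $2^{g(n)}$ steps on every graph with $n$ vertices. -/

import Mathlib

open Filter Asymptotics

namespace SubexpApprox

/-! ### Deterministic machines with a step count -/

/-- A deterministic machine with binary input and output: Mathlib's finite multi-stack
Turing machines. -/
abbrev Machine : Type 1 := Turing.TM2ComputableAux Bool Bool

/-- On input `x`, the machine `M` halts after at most `t` steps with output `y`. -/
def Machine.OutputsWithin (M : Machine) (x y : List Bool) (t : ℕ) : Prop :=
  Nonempty (Turing.TM2OutputsInTime M.tm (x.map M.inputAlphabet.invFun)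
    (some (y.map M.outputAlphabet.invFun)) t)

/-! ### 3-SAT and the Exponential Time Hypothesis -/

/-- A 3-CNF formula over the variables `0, …, numVars - 1`. A clause is a disjunction of three
literals, not necessarily distinct (so clauses with one or two literals are covered).
The literal `(v, true)` is the variable `v`, and `(v, false)` is its negation. -/
structure ThreeCNF where
  numVars : ℕ
  clauses : List (Fin 3 → Fin numVars × Bool)

namespace ThreeCNF

/-- Some truth assignment makes at least one literal of every clause true. -/
def Satisfiable (φ : ThreeCNF) : Prop :=
  ∃ τ : Fin φ.numVars → Bool, ∀ c ∈ φ.clauses, ∃ i, τ (c i).1 = (c i).2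

/-- The size of a formula: number of variables plus number of clauses. -/
def size (φ : ThreeCNF) : ℕ := φ.numVars + φ.clauses.length

/-- The code of a literal: its sign, then the index of its variable in unary, then `false`. -/
def encodeLiteral {n : ℕ} (l : Fin n × Bool) : List Bool :=
  l.2 :: (List.replicate l.1 true ++ [false])

/-- The code of a clause: the codes of its three literals. -/
def encodeClause {n : ℕ} (c : Fin 3 → Fin n × Bool) : List Bool :=
  encodeLiteral (c 0) ++ encodeLiteral (c 1) ++ encodeLiteral (c 2)

/-- The code of a formula: the number of variables in unary, then `false`, then its clauses.
Its length is polynomially bounded in the size of the formula. -/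
def encode (φ : ThreeCNF) : List Bool :=
  List.replicate φ.numVars true ++ false :: φ.clauses.flatMap encodeClause

end ThreeCNF

/-- `M` decides 3-SAT and takes at most `2 ^ g s` steps on formulas of size `s`. -/
def DecidesThreeSATInTime (M : Machine) (g : ℕ → ℝ) : Prop :=
  ∀ φ : ThreeCNF, ∃ (b : Bool) (t : ℕ), (b = true ↔ φ.Satisfiable) ∧
    (t : ℝ) ≤ (2 : ℝ) ^ g φ.size ∧ M.OutputsWithin φ.encode [b] t

/-- The (deterministic) Exponential Time Hypothesis: no `2 ^ o(s)`-time algorithm decides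
3-SAT on formulas of size `s`. -/
def ETH : Prop :=
  ¬ ∃ (M : Machine) (g : ℕ → ℝ),
    (g =o[atTop] fun s : ℕ => (s : ℝ)) ∧ DecidesThreeSATInTime M g

/-! ### Max Induced Path and its approximation algorithms -/

/-- The vertex set `S` induces a path in `G`. -/
def InducesPath {V : Type*} (G : SimpleGraph V) (S : Finset V) : Prop :=
  Nonempty (G.induce (S : Set V) ≃g SimpleGraph.pathGraph S.card)

/-- `S` is a `ρ`-approximate solution of Max Induced Path on `G`: it induces a path, and no
vertex set inducing a path is more than `ρ` times as large. -/
def IsApproxMaxInducedPath {V : Type*} (G : SimpleGraph V) (ρ : ℝ) (S : Finset V) : Prop :=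
  InducesPath G S ∧ ∀ T : Finset V, InducesPath G T → (T.card : ℝ) ≤ ρ * S.card

open Classical in
/-- The code of a graph on `n` vertices: the `n * n` bits of its adjacency matrix,
row after row. -/
noncomputable def encodeGraph {n : ℕ} (G : SimpleGraph (Fin n)) : List Bool :=
  (List.finRange n).flatMap fun u => (List.finRange n).map fun v => decide (G.Adj u v)

/-- The code of a vertex set: the `n` bits of its characteristic vector. -/
def encodeVertexSet {n : ℕ} (S : Finset (Fin n)) : List Bool :=
  (List.finRange n).map fun v => decide (v ∈ S)

/-- `M` is an `r`-approximation algorithm for Max Induced Path, where the ratio `r n` may depend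
on the number `n` of vertices, and it takes at most `2 ^ g n` steps on graphs with `n` vertices. -/
def ApproximatesMaxInducedPathInTime (M : Machine) (r g : ℕ → ℝ) : Prop :=
  ∀ (n : ℕ) (G : SimpleGraph (Fin n)), ∃ (S : Finset (Fin n)) (t : ℕ),
    IsApproxMaxInducedPath G (r n) S ∧
    (t : ℝ) ≤ (2 : ℝ) ^ g n ∧ M.OutputsWithin (encodeGraph G) (encodeVertexSet S) t

/-- The integer part of `r n` can be computed in time polynomial in `n` (both in unary). -/
def PolyTimeRatio (r : ℕ → ℝ) : Prop :=
  Nonempty (Turing.TM2ComputableInPolyTime Computability.unaryEncodeNat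
    Computability.unaryEncodeNat fun n => ⌊r n⌋₊)

end SubexpApprox

/-!
# Max Induced Path has no subexponential approximation under the ETH

An approximation algorithm for Max Induced Path is turned into an algorithm for 3-SAT.

**The graph.** Let `m` be the number of clauses of a formula. The clauses are laid out,
periodically, along `T` positions, and each position has seven vertices, one for each nonempty set
of literals of its clause. Such a vertex stands for the values of the variables of the clause that
make precisely these literals true. Two vertices are adjacent if they disagree about a variable, or
belong to consecutive positions (`clashGraph`). A satisfying assignment selects one vertex at each
position, and these vertices induce a path with `T` vertices (`exists_inducesPath_of_satisfying`).

Conversely, an induced path with more than `7 * m` vertices yields a satisfying assignment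
(`exists_satisfying_of_inducesPath`). If both values of a variable occur on the path, the vertices
concerned form a complete bipartite graph (up to vertices in both classes), so that they are among
three consecutive vertices of the path. Hence clauses with such a variable, the mixed ones, are
visited at most three times each. Away from them the path proceeds monotonically through the
positions. If the values that occur on the path do not satisfy the formula, some clause is visited
only if it is mixed, so between two visits of the same unmixed clause the path meets a mixed vertex.
The first one of these is determined, up to its three occurrences, by the direction of the path,
which bounds the number of visits by `3 + 3 + 1` (`PathEnum.card_visits_le`).

**The number of positions.** Let `T` be the least positive number with
`7 * m * (⌊r (7 * T)⌋₊ + 1) ≤ T`. Then an `r`-approximate solution has more than `7 * m` vertices if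
and only if the formula is satisfiable (`lt_card_iff_satisfiable`). As `r n ≤ n ^ (1 - ε)`, such a
`T` exists and is polynomial in `m`. As `T - 1` is too small and `r` drops by at most a constant
factor in seven steps, `7 * T / r (7 * T) = O(m)` (`exists_numPositions`). So a running time of
`2 ^ o(n / r n)` on the graph is a running time of `2 ^ o(m)` in terms of the formula, up to
polynomial factors (`isLittleO_logb_sum`).

**The machine.** The reduction has to be carried out by a multi-stack machine. A `Cmd` is a piece of
machine code with one entry and one exit, built from pushes, case distinctions on a popped bit,
loops, and calls of given machines (here: the approximation algorithm, and the machine for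
`⌊r n⌋₊`). `Cmd.decideFormula` is the whole program; the lemmas `ex_…` state what its parts do to
the registers and how many steps they take. Apart from the call of the approximation algorithm,
the time is polynomial in the numbers involved (`ex_decideClauses`).
-/

namespace SubexpApprox

open Turing Function

/-! ### Structured programs for stack machines -/

/-- The transition function `f` leads from `c` to `c'` in at most `t` steps. -/
def Reach {α : Type*} (f : α → Option α) (c c' : α) (t : ℕ) : Prop :=
  ∃ n ≤ t, (flip Bind.bind f)^[n] (some c) = some c'

namespace Reach

variable {α : Type*} {f : α → Option α} {c c' c'' : α} {t u : ℕ}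

theorem refl (c : α) : Reach f c c 0 := ⟨0, le_rfl, rfl⟩

theorem mono (h : Reach f c c' t) (htu : t ≤ u) : Reach f c c' u :=
  let ⟨n, hn, e⟩ := h
  ⟨n, hn.trans htu, e⟩

theorem trans (h₁ : Reach f c c' t) (h₂ : Reach f c' c'' u) : Reach f c c'' (t + u) := by
  obtain ⟨n, hn, e⟩ := h₁
  obtain ⟨k, hk, e'⟩ := h₂
  exact ⟨k + n, by omega, by rw [iterate_add_apply, e, e']⟩

theorem single (h : f c = some c') : Reach f c c' 1 :=
  ⟨1, le_rfl, h⟩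

theorem head (h : f c = some c') (h' : Reach f c' c'' t) : Reach f c c'' (t + 1) :=
  ((single h).trans h').mono (by omega)

end Reach

section Programs

variable (ι : Type) {J : Type} (F : J → Machine)

/-- The stacks of a program with registers `ι` and subroutines `F`: one stack for each register,
and all stacks of the machines `F j`. -/
abbrev Stk : Type := ι ⊕ (Σ j, (F j).tm.K)

/-- The alphabets of the stacks: registers hold bits. -/
@[reducible] def Sym : Stk ι F → Type
  | .inl _ => Bool
  | .inr k => (F k.1).tm.Γ k.2

/-- The internal state of a program: a buffer for the last symbol read, and the internal states of
the subroutines. -/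
abbrev Var : Type := Option Bool × (∀ j, (F j).tm.σ)

/-- The internal state in which every command starts and ends. -/
def idle : Var F := (none, fun j => (F j).tm.initialState)

variable {ι}

/-- Contents of all stacks, from the registers and the stacks of the subroutines. -/
def full (s : ι → List Bool) (U : ∀ j, ∀ k, List ((F j).tm.Γ k)) : ∀ k, List (Sym ι F k)
  | .inl i => s i
  | .inr k => U k.1 k.2

/-- The empty stacks of the subroutines. -/
def noStk : ∀ j, ∀ k, List ((F j).tm.Γ k) := fun _ _ => []

variable [DecidableEq ι] [DecidableEq J]

theorem update_full_inl (s : ι → List Bool) (U : ∀ j, ∀ k, List ((F j).tm.Γ k)) (i : ι)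
    (l : List Bool) :
    update (full F s U) (Sum.inl i) l = full F (update s i l) U := by
  funext k
  rcases k with k | k
  · by_cases h : k = i
    · subst h; simp [full]
    · rw [update_of_ne (by simpa using h)]; simp [full, h]
  · rw [update_of_ne (by simp)]; rfl

theorem update_full_inr (s : ι → List Bool) (U : ∀ j, ∀ k, List ((F j).tm.Γ k)) (j : J)
    (k : (F j).tm.K) (l : List ((F j).tm.Γ k)) :
    update (full F s U) (Sum.inr ⟨j, k⟩) l = full F s (update U j (update (U j) k l)) := by
  funext k'
  rcases k' with k' | ⟨j', k'⟩
  · rw [update_of_ne (by simp)]; rfl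
  · by_cases h : j' = j
    · subst h
      by_cases h' : k' = k
      · subst h'; simp [full]
      · rw [update_of_ne (by simpa using h')]; simp [full, h']
    · rw [update_of_ne (by simp [h])]; simp [full, h]

variable (ι)

/-- A command with registers `ι` and subroutines `F`: labelled machine code with one entry and one
exit, relocatable into any machine. Its code depends on the embedding `e` of its labels into those
of the machine and on the label `x` at which the computation goes on afterwards. -/
structure Cmd : Type 1 where
  Lab : Type
  fin : Finite Lab
  entry : ∀ {Λ : Type}, (Lab → Λ) → Λ → Λ
  code : ∀ {Λ : Type}, (Lab → Λ) → Λ → Lab → TM2.Stmt (Sym ι F) Λ (Var F)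

variable {ι F}

/-- From stack contents `S`, the command `P` terminates with stack contents `S'` after at most `t`
steps, in every machine that contains its code. -/
def Exec (P : Cmd ι F) (S S' : ∀ k, List (Sym ι F k)) (t : ℕ) : Prop :=
  ∀ ⦃Λ : Type⦄ (m : Λ → TM2.Stmt (Sym ι F) Λ (Var F)) (e : P.Lab → Λ) (x : Λ),
    (∀ l, m (e l) = P.code e x l) →
      Reach (TM2.step m) ⟨some (P.entry e x), idle F, S⟩ ⟨some x, idle F, S'⟩ t

/-- `Exec`, in terms of the registers, for a run that starts and ends with the stacks of all
subroutines empty. -/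
def Runs (P : Cmd ι F) (s s' : ι → List Bool) (t : ℕ) : Prop :=
  Exec P (full F s (noStk F)) (full F s' (noStk F)) t

theorem Exec.mono {P : Cmd ι F} {S S' t u} (h : Exec P S S' t) (htu : t ≤ u) : Exec P S S' u :=
  fun _ m e x hm => (h m e x hm).mono htu

namespace Cmd

/-- Do nothing. -/
def skip : Cmd ι F where
  Lab := Empty
  fin := inferInstance
  entry _ x := x
  code _ _ l := l.elim

/-- Push the bit `b` onto register `k`. -/
def push (k : ι) (b : Bool) : Cmd ι F where
  Lab := Unit
  fin := inferInstance
  entry e _ := e ()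
  code _ x _ := .push (Sum.inl k) (fun _ => b) (.goto fun _ => x)

/-- Run `P`, then `Q`. -/
def seq (P Q : Cmd ι F) : Cmd ι F where
  Lab := P.Lab ⊕ Q.Lab
  fin := have := P.fin; have := Q.fin; inferInstance
  entry e x := P.entry (fun l => e (.inl l)) (Q.entry (fun l => e (.inr l)) x)
  code e x l := match l with
    | .inl l => P.code (fun l => e (.inl l)) (Q.entry (fun l => e (.inr l)) x) l
    | .inr l => Q.code (fun l => e (.inr l)) x l

/-- Pop a bit of register `k` into the buffer, empty the buffer, and go to the label that `f`
assigns to the bit (`f none` if the register was empty). -/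
def popGoto {Λ : Type} (k : ι) (f : Option Bool → Λ) : TM2.Stmt (Sym ι F) Λ (Var F) :=
  .pop (Sum.inl k) (fun v (o : Option Bool) => (o, v.2)) <|
    .branch (fun v => v.1.isNone)
      (.load (fun v => (none, v.2)) <| .goto fun _ => f none)
      (.branch (fun v => v.1 == some true)
        (.load (fun v => (none, v.2)) <| .goto fun _ => f (some true))
        (.load (fun v => (none, v.2)) <| .goto fun _ => f (some false)))

/-- Pop a bit of register `k` and run the command that `f` assigns to it. -/
def cases (k : ι) (f : Option Bool → Cmd ι F) : Cmd ι F where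
  Lab := Option (Σ o, (f o).Lab)
  fin := have := fun o => (f o).fin; inferInstance
  entry e _ := e none
  code e x l := match l with
    | none => popGoto k fun o => (f o).entry (fun l => e (some ⟨o, l⟩)) x
    | some ⟨o, l⟩ => (f o).code (fun l => e (some ⟨o, l⟩)) x l

/-- Pop bits `b` of register `k` and run `P b` for each of them, until the register is empty or a
bit with `c b = false` has been popped. -/
def loop (k : ι) (c : Bool → Bool) (P : Bool → Cmd ι F) : Cmd ι F where
  Lab := Option (Σ b, (P b).Lab)
  fin := have := fun b => (P b).fin; inferInstance
  entry e _ := e none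
  code e x l := match l with
    | none => popGoto k fun o => match o with
      | none => x
      | some b => if c b then (P b).entry (fun l => e (some ⟨b, l⟩)) (e none) else x
    | some ⟨b, l⟩ => (P b).code (fun l => e (some ⟨b, l⟩)) (e none) l

/-- Move the bits of register `a` one by one to the input stack of subroutine `j`. -/
def feed (j : J) (a : ι) : Cmd ι F where
  Lab := Unit
  fin := inferInstance
  entry e _ := e ()
  code e x _ :=
    .pop (Sum.inl a) (fun v (o : Option Bool) => (o, v.2)) <|
      .branch (fun v => v.1.isNone) (.goto fun _ => x)
        (.push (Sum.inr ⟨j, (F j).tm.k₀⟩)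
          (fun v => (F j).inputAlphabet.symm (v.1.getD false)) <|
          .load (fun v => (none, v.2)) <| .goto fun _ => e ())

/-- Move the symbols of the output stack of subroutine `j` one by one to register `b`. -/
def drain (j : J) (b : ι) : Cmd ι F where
  Lab := Unit
  fin := inferInstance
  entry e _ := e ()
  code e x _ :=
    .pop (Sum.inr ⟨j, (F j).tm.k₁⟩)
        (fun v (o : Option ((F j).tm.Γ (F j).tm.k₁)) => (o.map (F j).outputAlphabet, v.2)) <|
      .branch (fun v => v.1.isNone) (.goto fun _ => x)
        (.push (Sum.inl b) (fun v => v.1.getD false) <|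
          .load (fun v => (none, v.2)) <| .goto fun _ => e ())

/-- The code of subroutine `j` as part of a larger machine, with `halt` replaced by a jump. -/
def liftStmt (j : J) {Λ : Type} (e : (F j).tm.Λ → Λ) (x : Λ) :
    TM2.Stmt (F j).tm.Γ (F j).tm.Λ (F j).tm.σ → TM2.Stmt (Sym ι F) Λ (Var F)
  | .push k f q => .push (Sum.inr ⟨j, k⟩) (fun v => f (v.2 j)) (liftStmt j e x q)
  | .peek k f q => .peek (Sum.inr ⟨j, k⟩)
      (fun v (o : Option ((F j).tm.Γ k)) => (v.1, update v.2 j (f (v.2 j) o))) (liftStmt j e x q)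
  | .pop k f q => .pop (Sum.inr ⟨j, k⟩)
      (fun v (o : Option ((F j).tm.Γ k)) => (v.1, update v.2 j (f (v.2 j) o))) (liftStmt j e x q)
  | .load f q => .load (fun v => (v.1, update v.2 j (f (v.2 j)))) (liftStmt j e x q)
  | .branch f q₁ q₂ => .branch (fun v => f (v.2 j)) (liftStmt j e x q₁) (liftStmt j e x q₂)
  | .goto f => .goto fun v => e (f (v.2 j))
  | .halt => .goto fun _ => x

/-- Run subroutine `j` on the present contents of its stacks. -/
def run (j : J) : Cmd ι F where
  Lab := (F j).tm.Λ
  fin := have := (F j).tm.ΛFin; inferInstance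
  entry e _ := e (F j).tm.main
  code e x l := liftStmt j e x ((F j).tm.m l)

/-- Run subroutine `j` on the word in register `a` and put its output onto register `b`. Both are
reversed on the way. -/
def call (j : J) (a b : ι) : Cmd ι F := (feed j a).seq ((run j).seq (drain j b))

end Cmd

open Cmd

theorem Exec.seq {P Q : Cmd ι F} {S S' S'' t u} (h₁ : Exec P S S' t) (h₂ : Exec Q S' S'' u) :
    Exec (P.seq Q) S S'' (t + u) := fun _ m e x hm =>
  (h₁ m (fun l => e (.inl l)) _ fun l => hm (.inl l)).trans
    (h₂ m (fun l => e (.inr l)) x fun l => hm (.inr l))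

namespace Runs

variable {P Q : Cmd ι F} {s s' s'' : ι → List Bool} {t u : ℕ}

theorem mono (h : Runs P s s' t) (htu : t ≤ u) : Runs P s s' u := Exec.mono h htu

theorem skip (s : ι → List Bool) : Runs (Cmd.skip : Cmd ι F) s s 0 :=
  fun _ _ _ _ _ => Reach.refl _

theorem seq (h₁ : Runs P s s' t) (h₂ : Runs Q s' s'' u) : Runs (P.seq Q) s s'' (t + u) :=
  Exec.seq h₁ h₂

theorem push (k : ι) (b : Bool) (s : ι → List Bool) :
    Runs (Cmd.push k b : Cmd ι F) s (update s k (b :: s k)) 1 := by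
  intro Λ m e x hm
  refine Reach.single ?_
  have := hm ()
  simp only [Cmd.push] at this ⊢
  rw [TM2.step, this]
  simp only [TM2.stepAux]
  rw [← update_full_inl]
  rfl

theorem stepAux_popGoto {Λ : Type} (k : ι) (f : Option Bool → Λ) (s : ι → List Bool) :
    TM2.stepAux (popGoto k f) (idle F) (full F s (noStk F)) =
      ⟨some (f (s k).head?), idle F, full F (update s k (s k).tail) (noStk F)⟩ := by
  simp only [popGoto, TM2.stepAux]
  rw [← update_full_inl]
  have : full F s (noStk F) (Sum.inl k) = s k := rfl
  simp only [this]
  rcases h : s k with _ | ⟨b, l⟩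
  · rfl
  · cases b <;> rfl

theorem cases {k : ι} {f : Option Bool → Cmd ι F}
    (h : Runs (f (s k).head?) (update s k (s k).tail) s' t) :
    Runs (Cmd.cases k f) s s' (t + 1) := by
  intro Λ m e x hm
  refine Reach.head ?_ (h m (fun l => e (some ⟨_, l⟩)) x fun l => hm (some ⟨_, l⟩))
  have := hm none
  simp only [Cmd.cases] at this ⊢
  rw [TM2.step, this, stepAux_popGoto]

theorem loop_nil {k : ι} {c : Bool → Bool} {P : Bool → Cmd ι F} (h : s k = []) :
    Runs (Cmd.loop k c P) s s 1 := by
  intro Λ m e x hm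
  refine Reach.single ?_
  have := hm none
  simp only [Cmd.loop] at this ⊢
  rw [TM2.step, this, stepAux_popGoto, h]
  congr
  rw [List.tail_nil, ← h, update_eq_self]

theorem loop_stop {k : ι} {c : Bool → Bool} {P : Bool → Cmd ι F} {b : Bool} {l : List Bool}
    (h : s k = b :: l) (hb : c b = false) :
    Runs (Cmd.loop k c P) s (update s k l) 1 := by
  intro Λ m e x hm
  refine Reach.single ?_
  have := hm none
  simp only [Cmd.loop] at this ⊢
  rw [TM2.step, this, stepAux_popGoto, h]
  simp [hb]

theorem loop_cons {k : ι} {c : Bool → Bool} {P : Bool → Cmd ι F} {b : Bool} {l : List Bool}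
    (h : s k = b :: l) (hb : c b = true) (h₁ : Runs (P b) (update s k l) s' t)
    (h₂ : Runs (Cmd.loop k c P) s' s'' u) :
    Runs (Cmd.loop k c P) s s'' (t + u + 1) := by
  intro Λ m e x hm
  refine Reach.head ?_ ((h₁ m (fun l => e (some ⟨_, l⟩)) (e none) fun l => hm (some ⟨_, l⟩)).trans
    (h₂ m e x hm))
  have := hm none
  simp only [Cmd.loop] at this ⊢
  rw [TM2.step, this, stepAux_popGoto, h]
  simp [hb]

end Runs

/-- The symbols of a register arrive on the input stack in reversed order. -/
theorem exec_feed (j : J) (a : ι) (s : ι → List Bool) (U : ∀ k, List ((F j).tm.Γ k)) :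
    Exec (Cmd.feed j a : Cmd ι F) (full F s (update (noStk F) j U))
      (full F (update s a []) (update (noStk F) j (update U (F j).tm.k₀
        ((s a).reverse.map (F j).inputAlphabet.symm ++ U (F j).tm.k₀)))) ((s a).length + 1) := by
  intro Λ m e x hm
  have hm := hm ()
  generalize hl : s a = l
  have h1 : full F s (update (noStk F) j U) (Sum.inl a) = l := hl
  induction l generalizing s U with
  | nil =>
    refine Reach.single ?_
    simp only [Cmd.feed] at hm ⊢
    rw [TM2.step, hm]
    simp only [TM2.stepAux, h1, List.tail_nil, List.head?_nil, update_full_inl]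
    simp [idle]
  | cons b l ih =>
    have ih := ih (update s a l) (update U (F j).tm.k₀ ((F j).inputAlphabet.symm b :: U _))
      (by simp) (by simp [full])
    simp only [update_idem, update_self] at ih
    have h2 := Reach.head (f := TM2.step m)
      (c := ⟨some ((Cmd.feed j a).entry e x), idle F, full F s (update (noStk F) j U)⟩) ?_ ih
    · simpa using h2
    · simp only [Cmd.feed] at hm ⊢
      rw [TM2.step, hm]
      simp only [TM2.stepAux, h1, List.tail_cons, List.head?_cons, update_full_inl,
        update_full_inr]
      simp [idle, full]

/-- The symbols of an output stack arrive on the register in reversed order. -/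
theorem exec_drain (j : J) (b : ι) (s : ι → List Bool) (U : ∀ k, List ((F j).tm.Γ k)) :
    Exec (Cmd.drain j b : Cmd ι F) (full F s (update (noStk F) j U))
      (full F (update s b (((U (F j).tm.k₁).map (F j).outputAlphabet).reverse ++ s b))
        (update (noStk F) j (update U (F j).tm.k₁ []))) ((U (F j).tm.k₁).length + 1) := by
  intro Λ m e x hm
  have hm := hm ()
  generalize hl : U (F j).tm.k₁ = l
  have h1 : full F s (update (noStk F) j U) (Sum.inr ⟨j, (F j).tm.k₁⟩) = l := by
    simpa [full] using hl
  induction l generalizing s U with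
  | nil =>
    refine Reach.single ?_
    simp only [Cmd.drain] at hm ⊢
    rw [TM2.step, hm]
    simp only [TM2.stepAux, h1, List.tail_nil, List.head?_nil, update_full_inr]
    simp [idle]
  | cons c l ih =>
    have ih := ih (update s b ((F j).outputAlphabet c :: s b)) (update U (F j).tm.k₁ l)
      (by simp) (by simp [full])
    simp only [update_idem, update_self] at ih
    have h2 := Reach.head (f := TM2.step m)
      (c := ⟨some ((Cmd.drain j b).entry e x), idle F, full F s (update (noStk F) j U)⟩) ?_ ih
    · simpa using h2
    · simp only [Cmd.drain] at hm ⊢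
      rw [TM2.step, hm]
      simp only [TM2.stepAux, h1, List.tail_cons, List.head?_cons, update_full_inl,
        update_full_inr]
      simp [idle, full]

theorem initList_eq (tm : FinTM2) (l : List (tm.Γ tm.k₀)) :
    initList tm l = ⟨some tm.main, tm.initialState, update (fun _ => []) tm.k₀ l⟩ := by
  unfold initList
  congr 1
  funext k
  by_cases hk : k = tm.k₀
  · subst hk; simp
  · simp [hk]

theorem haltList_eq (tm : FinTM2) (l : List (tm.Γ tm.k₁)) :
    haltList tm l = ⟨none, tm.initialState, update (fun _ => []) tm.k₁ l⟩ := by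
  unfold haltList
  congr 1
  funext k
  by_cases hk : k = tm.k₁
  · subst hk; simp
  · simp [hk]

/-- The configuration of the large machine that corresponds to a configuration of subroutine `j`:
the halting label of `j` becomes the exit label `x`. -/
def embedCfg (s : ι → List Bool) (j : J) {Λ : Type} (e : (F j).tm.Λ → Λ) (x : Λ)
    (c : (F j).tm.Cfg) : TM2.Cfg (Sym ι F) Λ (Var F) :=
  ⟨some (c.l.elim x e), (none, update (idle F).2 j c.var), full F s (update (noStk F) j c.stk)⟩

/-- The lifted code of subroutine `j` simulates the statements of `j`. -/
theorem stepAux_liftStmt (s : ι → List Bool) (j : J) {Λ : Type} (e : (F j).tm.Λ → Λ) (x : Λ)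
    (q : TM2.Stmt (F j).tm.Γ (F j).tm.Λ (F j).tm.σ) (v : (F j).tm.σ)
    (U : ∀ k, List ((F j).tm.Γ k)) :
    TM2.stepAux (liftStmt j e x q) (none, update (idle F).2 j v)
      (full F s (update (noStk F) j U)) = embedCfg s j e x (TM2.stepAux q v U) := by
  have hU (U : ∀ k, List ((F j).tm.Γ k)) (k : (F j).tm.K) :
      full F s (update (noStk F) j U) (Sum.inr ⟨j, k⟩) = U k := by simp [full]
  induction q generalizing v U with
  | push k f q ih =>
    simp only [liftStmt, TM2.stepAux, update_full_inr, hU]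
    simp [ih]
  | peek k f q ih =>
    simp only [liftStmt, TM2.stepAux, hU]
    simp [ih]
  | pop k f q ih =>
    simp only [liftStmt, TM2.stepAux, update_full_inr, hU]
    simp [ih]
  | load f q ih => simp [liftStmt, ih]
  | branch f q₁ q₂ ih₁ ih₂ =>
    simp only [liftStmt, TM2.stepAux, update_self]
    cases f v <;> simp [ih₁, ih₂]
  | goto f => simp [liftStmt, embedCfg]
  | halt => simp [liftStmt, embedCfg]

/-- A halting computation of a machine is a terminating run of the subroutine. It leaves the
internal state and all stacks except for the output stack as they were before, so that the
subroutine can be called again. -/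
theorem exec_run (j : J) (s : ι → List Bool) {l l' : List Bool} {t : ℕ}
    (h : (F j).OutputsWithin l l' t) :
    Exec (Cmd.run j : Cmd ι F)
      (full F s (update (noStk F) j (update (noStk F j) (F j).tm.k₀
        (l.map (F j).inputAlphabet.symm))))
      (full F s (update (noStk F) j (update (noStk F j) (F j).tm.k₁
        (l'.map (F j).outputAlphabet.symm)))) t := by
  intro Λ m e x hm
  obtain ⟨⟨⟨n, hn⟩, hnt⟩⟩ := h
  refine ⟨n, hnt, ?_⟩
  have key : ∀ (n : ℕ) (c c' : (F j).tm.Cfg),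
      (flip Bind.bind (F j).tm.step)^[n] (some c) = some c' →
      (flip Bind.bind (TM2.step m))^[n] (some (embedCfg s j e x c)) =
        some (embedCfg s j e x c') := by
    intro n
    induction n with
    | zero => intro c c' h; simp only [iterate_zero, id, Option.some.injEq] at h ⊢; rw [h]
    | succ n ih =>
      intro c c' h
      rw [iterate_succ_apply] at h ⊢
      rcases hc : c.l with _ | lab
      · have h0 : flip Bind.bind (F j).tm.step (some c) = none := by
          rcases c with ⟨_, v, S⟩
          cases hc
          rfl
        rw [h0] at h
        have : ∀ k, (flip Bind.bind (F j).tm.step)^[k] none = none := fun k =>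
          iterate_fixed rfl k
        rw [this] at h
        cases h
      · rcases c with ⟨_, v, S⟩
        cases hc
        have h0 : flip Bind.bind (F j).tm.step (some ⟨some lab, v, S⟩) =
          some (TM2.stepAux ((F j).tm.m lab) v S) := rfl
        rw [h0] at h
        rw [← ih _ _ h]
        congr 1
        have : flip Bind.bind (TM2.step m) (some (embedCfg s j e x ⟨some lab, v, S⟩)) =
          some (TM2.stepAux (m (e lab)) (none, update (idle F).2 j v)
            (full F s (update (noStk F) j S))) := rfl
        rw [this, hm lab]
        exact congrArg some (stepAux_liftStmt s j e x _ v S)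
  have := key n _ _ hn
  rw [initList_eq, haltList_eq] at this
  have hi : update (idle F).2 j (F j).tm.initialState = (idle F).2 := update_eq_self _ _
  simp only [embedCfg, hi] at this
  exact this

/-- Since `Cmd.call` reverses words, the register `a` has to contain the input backwards. -/
theorem Runs.call {j : J} {a b : ι} {s : ι → List Bool} {l l' : List Bool} {t : ℕ}
    (hl : s a = l.reverse) (h : (F j).OutputsWithin l l' t) :
    Runs (Cmd.call j a b : Cmd ι F) s
      (update (update s a []) b (l'.reverse ++ update s a [] b))
      (t + l.length + l'.length + 2) := by
  have h1 := exec_feed (F := F) j a s (noStk F j)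
  rw [update_eq_self, hl] at h1
  simp only [List.reverse_reverse, noStk, List.append_nil, List.length_reverse] at h1
  have h2 := exec_run (ι := ι) j (update s a []) h
  have h3 :=
    exec_drain (F := F) j b (update s a []) (update (noStk F j) (F j).tm.k₁
        (l'.map (F j).outputAlphabet.symm))
  simp only [update_self, List.map_map, update_idem, List.length_map] at h3
  have := Exec.mono (Exec.seq h1 (Exec.seq h2 h3)) (u := t + l.length + l'.length + 2) (by omega)
  unfold Runs
  have h0 : update (noStk F j) (F j).tm.k₁ [] = noStk F j := update_eq_self _ _
  rw [h0, update_eq_self] at this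
  simpa [Cmd.call] using this

end Programs

/-! ### From programs to machines -/

section Compile

variable {ι J : Type} [DecidableEq ι] [Fintype ι] [DecidableEq J] [Fintype J] {F : J → Machine}

/-- The machine that runs the program `P` on the word in register `inp`; its output is the word in
register `out`. -/
noncomputable def Cmd.toMachine (P : Cmd ι F) (inp out : ι) : Machine where
  tm :=
    { K := Stk ι F
      kDecidableEq := inferInstance
      kFin := have := fun j => (F j).tm.kFin; inferInstance
      k₀ := .inl inp
      k₁ := .inl out
      Γ := Sym ι F
      Λ := Option P.Lab
      main := P.entry some none
      ΛFin := have := P.fin; Fintype.ofFinite _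
      σ := Var F
      initialState := idle F
      σFin := have := fun j => (F j).tm.σFin; inferInstance
      Γk₀Fin := inferInstanceAs (Fintype Bool)
      m := fun l => match l with
        | none => .halt
        | some l => P.code some none l }
  inputAlphabet := Equiv.refl Bool
  outputAlphabet := Equiv.refl Bool

/-- The last step is taken by the statement `halt` at the label `none`. -/
theorem Runs.outputsWithin {P : Cmd ι F} {inp out : ι} {l l' : List Bool} {t : ℕ}
    (h : Runs P (update (fun _ => []) inp l) (update (fun _ => []) out l') t) :
    (P.toMachine inp out).OutputsWithin l l' (t + 1) := by
  have h1 := h (P.toMachine inp out).tm.m some none fun _ => rfl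
  obtain ⟨n, hn, e⟩ := h1.trans (Reach.single (c' := ⟨none, idle F, _⟩) rfl)
  refine ⟨⟨⟨n, ?_⟩, hn⟩⟩
  have h0 : full F (fun _ : ι => []) (noStk F) = fun _ => [] := by
    funext k; rcases k with k | k <;> rfl
  have key (i : ι) (l : List Bool) : full F (update (fun _ => []) i l) (noStk F) =
      (update (fun _ => []) (Sum.inl i) l : ∀ k, List (Sym ι F k)) := by
    rw [← update_full_inl, h0]
  rw [key, key] at e
  rw [initList_eq, Option.map_some, haltList_eq]
  exact (congrArg _ (by simp [Cmd.toMachine]; rfl)).trans (e.trans (by simp [Cmd.toMachine]; rfl))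

end Compile

/-! ### Moving and copying registers -/

section Subroutines

variable {ι J : Type} {F : J → Machine} [DecidableEq ι] [DecidableEq J]

namespace Cmd

/-- Push `n` copies of the bit `b` onto register `k`. -/
def pushN (k : ι) (b : Bool) : ℕ → Cmd ι F
  | 0 => skip
  | n + 1 => (push k b).seq (pushN k b n)

/-- Run `P` if the bit `b`, known when the program is written, is true. -/
def when (b : Bool) (P : Cmd ι F) : Cmd ι F := if b then P else skip

/-- Empty register `a`. -/
def clear (a : ι) : Cmd ι F := loop a (fun _ => true) fun _ => skip

/-- Move the bits of register `a` one by one onto register `b`, which reverses them. -/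
def move (a b : ι) : Cmd ι F := loop a (fun _ => true) fun x => push b x

/-- Read a number in unary from register `a`, up to the `false` that ends it, and add it to the
unary number in register `b`. -/
def moveUnary (a b : ι) : Cmd ι F := loop a id fun _ => push b true

/-- Put the bits of register `a`, each of them `n` times, onto register `b`, with the help of the
empty register `tmp`. -/
def copy (n : ℕ) (a b tmp : ι) : Cmd ι F :=
  (move a tmp).seq (loop tmp (fun _ => true) fun x => (push a x).seq (pushN b x n))

end Cmd

namespace Runs

variable {a b tmp : ι} {s : ι → List Bool}

theorem congr {P : Cmd ι F} {s₁ s₂ s s' : ι → List Bool} {t u : ℕ} (h : Runs P s₁ s₂ t)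
    (h₁ : s₁ = s) (h₂ : s₂ = s') (htu : t ≤ u) : Runs P s s' u := by
  subst h₁ h₂
  exact h.mono htu

theorem pushN (k : ι) (b : Bool) (n : ℕ) (s : ι → List Bool) :
    Runs (Cmd.pushN k b n : Cmd ι F) s (update s k (List.replicate n b ++ s k)) n := by
  induction n generalizing s with
  | zero => exact (Runs.skip s).congr rfl (by simp) le_rfl
  | succ n ih =>
    exact ((Runs.push (F := F) k b s).seq (ih _)).congr rfl
      (by simp [List.replicate_succ']) (by omega)

theorem clear (a : ι) (s : ι → List Bool) :
    Runs (Cmd.clear a : Cmd ι F) s (update s a []) ((s a).length + 1) := by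
  generalize hl : s a = l
  induction l generalizing s with
  | nil => exact (Runs.loop_nil hl).congr rfl (by rw [← hl, update_eq_self]) (by simp)
  | cons x l ih =>
    exact (Runs.loop_cons (c := fun _ => true) hl rfl (Runs.skip (F := F) _)
      (ih (update s a l) (by simp))).congr rfl (by simp) (by simp)

theorem move (hab : a ≠ b) (s : ι → List Bool) :
    Runs (Cmd.move a b : Cmd ι F) s (update (update s a []) b ((s a).reverse ++ s b))
      (2 * (s a).length + 1) := by
  generalize hl : s a = l
  induction l generalizing s with
  | nil =>
    refine (Runs.loop_nil hl).congr rfl ?_ (by simp)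
    rw [← hl, update_eq_self]; simp [hl]
  | cons x l ih =>
    refine (Runs.loop_cons (c := fun _ => true) (P := fun x => Cmd.push b x) hl rfl
      (Runs.push (F := F) b x _) (ih _ (by simp [hab]))).congr rfl ?_ (by simp; omega)
    funext i
    by_cases hi : i = b
    · subst hi; simp [hab.symm]
    · by_cases hi' : i = a
      · subst hi'; simp [hab]
      · simp [hi, hi']

theorem moveUnary (hab : a ≠ b) (n : ℕ) (r : List Bool) (s : ι → List Bool)
    (hl : s a = List.replicate n true ++ false :: r) :
    Runs (Cmd.moveUnary a b : Cmd ι F) s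
      (update (update s a r) b (List.replicate n true ++ s b)) (2 * n + 1) := by
  induction n generalizing s with
  | zero =>
    refine (Runs.loop_stop hl rfl).congr rfl ?_ (by simp)
    funext i
    by_cases hi : i = b
    · subst hi; simp [hab.symm]
    · simp [hi]
  | succ n ih =>
    refine (Runs.loop_cons (c := id) (P := fun x => Cmd.push b true) hl rfl
      (Runs.push (F := F) b true _) (ih _ (by rw [update_of_ne hab]; simp))).congr rfl ?_ (by omega)
    funext i
    by_cases hi : i = b
    · subst hi; simp [hab.symm, List.replicate_succ']
    · by_cases hi' : i = a
      · subst hi'; simp [hab]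
      · simp [hi, hi']

theorem copy (hab : a ≠ b) (hat : a ≠ tmp) (hbt : b ≠ tmp) (n : ℕ) (s : ι → List Bool)
    (ht : s tmp = []) :
    Runs (Cmd.copy n a b tmp : Cmd ι F) s
      (update s b ((s a).flatMap (List.replicate n) ++ s b))
      ((n + 4) * (s a).length + 2) := by
  have h2 (l : List Bool) : ∀ s : ι → List Bool, s tmp = l →
      Runs (Cmd.loop tmp (fun _ => true) fun x => (Cmd.push a x).seq (Cmd.pushN b x n) : Cmd ι F) s
        (update (update (update s tmp []) a (l.reverse ++ s a)) b
          (l.reverse.flatMap (List.replicate n) ++ s b)) ((n + 2) * l.length + 1) := by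
    induction l with
    | nil =>
      intro s hs
      refine (Runs.loop_nil hs).congr rfl ?_ (by simp)
      rw [← hs, update_eq_self]; simp [hs]
    | cons x l ih =>
      intro s hs
      refine (Runs.loop_cons (c := fun _ => true)
        (P := fun x => (Cmd.push a x).seq (Cmd.pushN b x n)) hs rfl
        ((Runs.push (F := F) a x _).seq (Runs.pushN b x n _))
        (ih _ (by rw [update_of_ne hbt.symm, update_of_ne hat.symm, update_self]))).congr rfl ?_
        (by simp only [List.length_cons]; ring_nf; omega)
      funext i
      by_cases hi : i = b
      · subst hi; simp [hab.symm, hbt]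
      · by_cases hi' : i = a
        · subst hi'; simp [hab, hat]
        · by_cases hi'' : i = tmp
          · subst hi''; simp [hi, hi']
          · simp [hi, hi', hi'']
  refine ((Runs.move (F := F) hat s).seq (h2 (s a).reverse _ (by simp [ht]))).congr rfl ?_
    (by simp only [List.length_reverse]; ring_nf; omega)
  funext i
  by_cases hi : i = b
  · subst hi; simp [hab.symm, hbt]
  · by_cases hi' : i = a
    · subst hi'; simp [hab, hat]
    · by_cases hi'' : i = tmp
      · subst hi''; simp [hi, hi', ht]
      · simp [hi, hi', hi'']

end Runs

end Subroutines

/-! ### The registers -/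

/-- The registers of the program that decides 3-SAT:
* `inp`, `out`: input and output;
* `vc`, `mc`, `tc`, `wc`: the number `v` of variables, the number `m` of clauses, the number `T` of
  positions, and the length `v + T + 1` of the records of the vertices, in unary;
* `cl`, `rr`: the code of the clauses, and the part of it that has not been used yet;
* `rin`, `rout`, `kk`, `fl`: input and output of the subroutine for the ratio, a counter, a flag;
* `u0`, `u1`, `u2`, `po`: the variables of the present clause and `v` plus the present position, in
  unary with a final `false`; `c0`, …, `c4`, `cw`: copies of them and of `wc` that are consumed;
* `xx`, `x1`, `x2`, `x3`: lists of records;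
* `aa`, `ab`, `dg`, `de`: a row that is compared with all columns, its copy, and words that tell
  where the diagonal of the matrix is;
* `yy`, `zz`: the adjacency matrix and the output of the approximation algorithm;
* `tmp`: auxiliary. -/
inductive Reg
  | inp | out | vc | mc | cl | tmp | tc | rin | rout | kk | fl | rr | u0 | u1 | u2 | po | wc
  | c0 | c1 | c2 | c3 | c4 | cw | xx | x1 | x2 | x3 | aa | ab | dg | de | yy | zz
  deriving DecidableEq

instance : Fintype Reg where
  elems := {.inp, .out, .vc, .mc, .cl, .tmp, .tc, .rin, .rout, .kk, .fl, .rr, .u0, .u1, .u2, .po,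
    .wc, .c0, .c1, .c2, .c3, .c4, .cw, .xx, .x1, .x2, .x3, .aa, .ab, .dg, .de, .yy, .zz}
  complete k := by cases k <;> decide

/-- The contents of all registers. -/
structure St where
  (inp out vc mc cl tmp tc rin rout kk fl rr u0 u1 u2 po wc : List Bool)
  (c0 c1 c2 c3 c4 cw xx x1 x2 x3 aa ab dg de yy zz : List Bool)

namespace St

/-- The contents of register `k`. -/
def get (s : St) : Reg → List Bool
  | .inp => s.inp | .out => s.out | .vc => s.vc | .mc => s.mc | .cl => s.cl | .tmp => s.tmp
  | .tc => s.tc | .rin => s.rin | .rout => s.rout | .kk => s.kk | .fl => s.fl | .rr => s.rr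
  | .u0 => s.u0 | .u1 => s.u1 | .u2 => s.u2 | .po => s.po | .wc => s.wc | .c0 => s.c0
  | .c1 => s.c1 | .c2 => s.c2 | .c3 => s.c3 | .c4 => s.c4 | .cw => s.cw | .xx => s.xx
  | .x1 => s.x1 | .x2 => s.x2 | .x3 => s.x3 | .aa => s.aa | .ab => s.ab | .dg => s.dg
  | .de => s.de | .yy => s.yy | .zz => s.zz

/-- Replace the contents of register `k` by `l`. -/
def set (s : St) (k : Reg) (l : List Bool) : St :=
  match k with
  | .inp => { s with inp := l } | .out => { s with out := l } | .vc => { s with vc := l }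
  | .mc => { s with mc := l } | .cl => { s with cl := l } | .tmp => { s with tmp := l }
  | .tc => { s with tc := l } | .rin => { s with rin := l } | .rout => { s with rout := l }
  | .kk => { s with kk := l } | .fl => { s with fl := l } | .rr => { s with rr := l }
  | .u0 => { s with u0 := l } | .u1 => { s with u1 := l } | .u2 => { s with u2 := l }
  | .po => { s with po := l } | .wc => { s with wc := l } | .c0 => { s with c0 := l }
  | .c1 => { s with c1 := l } | .c2 => { s with c2 := l } | .c3 => { s with c3 := l }
  | .c4 => { s with c4 := l } | .cw => { s with cw := l } | .xx => { s with xx := l }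
  | .x1 => { s with x1 := l } | .x2 => { s with x2 := l } | .x3 => { s with x3 := l }
  | .aa => { s with aa := l } | .ab => { s with ab := l } | .dg => { s with dg := l }
  | .de => { s with de := l } | .yy => { s with yy := l } | .zz => { s with zz := l }

theorem get_set (s : St) (k : Reg) (l : List Bool) : (s.set k l).get = update s.get k l := by
  funext i
  by_cases h : i = k
  · subst h; rw [update_self]; cases i <;> rfl
  · rw [update_of_ne h]
    cases k <;> cases i <;> first | rfl | exact absurd rfl h

theorem set_get (s : St) (k : Reg) : s.set k (s.get k) = s := by cases k <;> rfl

/-- All registers are empty. -/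
def empty : St :=
  ⟨[], [], [], [], [], [], [], [], [], [], [], [], [], [], [], [], [], [], [], [], [], [], [], [],
    [], [], [], [], [], [], [], [], []⟩

end St

/-! ### Rules for programs on these registers -/

section Rules

variable {J : Type} {F : J → Machine} [DecidableEq J]

/-- From register contents `s`, the program `P` terminates with register contents `s'` after at
most `t` steps. -/
def Ex (P : Cmd Reg F) (s s' : St) (t : ℕ) : Prop := Runs P s.get s'.get t

/-- Sequential composition of commands. -/
infixr:60 " ;; " => Cmd.seq

namespace Ex

variable {P Q : Cmd Reg F} {s s' s'' : St} {t u n : ℕ} {k a b d : Reg} {l r : List Bool} {x : Bool}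

theorem mono (h : Ex P s s' t) (htu : t ≤ u) : Ex P s s' u := Runs.mono h htu

theorem skip (s : St) : Ex (Cmd.skip : Cmd Reg F) s s 0 := Runs.skip _

theorem seq (h₁ : Ex P s s' t) (h₂ : Ex Q s' s'' u) : Ex (P ;; Q) s s'' (t + u) :=
  Runs.seq h₁ h₂

theorem push (k : Reg) (x : Bool) (s : St) :
    Ex (Cmd.push k x : Cmd Reg F) s (s.set k (x :: s.get k)) 1 := by
  rw [Ex, St.get_set]; exact Runs.push k x _

theorem push_seq (h : Ex Q (s.set k (x :: s.get k)) s' t) :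
    Ex (Cmd.push k x ;; Q) s s' (1 + t) := (Ex.push k x s).seq h

theorem when_push (b : Bool) (k : Reg) (x : Bool) (s : St) :
    Ex (Cmd.when b (Cmd.push k x) : Cmd Reg F) s
      (s.set k (if b then x :: s.get k else s.get k)) 1 := by
  cases b
  · simp only [Bool.false_eq_true, if_false, St.set_get]
    exact (Ex.skip s).mono (by omega)
  · exact Ex.push k x s

theorem cases_some {f : Option Bool → Cmd Reg F} (h : s.get k = x :: l)
    (h' : Ex (f (some x)) (s.set k l) s' t) : Ex (Cmd.cases k f) s s' (t + 1) := by
  refine Runs.cases ?_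
  rw [h, ← St.get_set]
  exact h'

theorem cases_none {f : Option Bool → Cmd Reg F} (h : s.get k = [])
    (h' : Ex (f none) s s' t) : Ex (Cmd.cases k f) s s' (t + 1) := by
  refine Runs.cases ?_
  rw [h, List.tail_nil, ← h, update_eq_self, h]
  exact h'

/-- A case distinction without any information on the register. -/
theorem cases_head {f : Option Bool → Cmd Reg F}
    (h : Ex (f (s.get k).head?) (s.set k (s.get k).tail) s' t) :
    Ex (Cmd.cases k f) s s' (t + 1) := by
  cases hl : s.get k with
  | nil =>
    rw [hl] at h
    refine Ex.cases_none hl ?_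
    have : s.set k [] = s := by rw [← hl, St.set_get]
    rwa [List.tail_nil, this] at h
  | cons x l =>
    rw [hl] at h
    exact Ex.cases_some hl h

theorem loop_nil {c : Bool → Bool} {P : Bool → Cmd Reg F} (h : s.get k = []) :
    Ex (Cmd.loop k c P) s s 1 := Runs.loop_nil h

theorem loop_stop {c : Bool → Bool} {P : Bool → Cmd Reg F} (h : s.get k = x :: l)
    (hb : c x = false) : Ex (Cmd.loop k c P) s (s.set k l) 1 := by
  rw [Ex, St.get_set]; exact Runs.loop_stop h hb

theorem loop_cons {c : Bool → Bool} {P : Bool → Cmd Reg F} (h : s.get k = x :: l)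
    (hb : c x = true) (h₁ : Ex (P x) (s.set k l) s' t) (h₂ : Ex (Cmd.loop k c P) s' s'' u) :
    Ex (Cmd.loop k c P) s s'' (t + u + 1) := by
  rw [Ex, St.get_set] at h₁
  exact Runs.loop_cons h hb h₁ h₂

theorem loop_cons_le {c : Bool → Bool} {P : Bool → Cmd Reg F} {v : ℕ} (h : s.get k = x :: l)
    (hb : c x = true) (h₁ : Ex (P x) (s.set k l) s' t) (h₂ : Ex (Cmd.loop k c P) s' s'' u)
    (hv : t + u + 1 ≤ v) : Ex (Cmd.loop k c P) s s'' v :=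
  (loop_cons h hb h₁ h₂).mono hv

theorem loop_nil_le {c : Bool → Bool} {P : Bool → Cmd Reg F} (h : s.get k = []) (ht : 1 ≤ t) :
    Ex (Cmd.loop k c P) s s t := (loop_nil h).mono ht

theorem clear (h : s.get a = l) :
    Ex (Cmd.clear a : Cmd Reg F) s (s.set a []) (l.length + 1) := by
  subst h
  rw [Ex, St.get_set]; exact Runs.clear a _

theorem move (hab : a ≠ b) (h : s.get a = l) :
    Ex (Cmd.move a b : Cmd Reg F) s ((s.set a []).set b (l.reverse ++ s.get b))
      (2 * l.length + 1) := by
  subst h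
  rw [Ex, St.get_set, St.get_set]; exact Runs.move hab _

theorem moveUnary (hab : a ≠ b) (h : s.get a = List.replicate n true ++ false :: r) :
    Ex (Cmd.moveUnary a b : Cmd Reg F) s ((s.set a r).set b (List.replicate n true ++ s.get b))
      (2 * n + 1) := by
  rw [Ex, St.get_set, St.get_set]; exact Runs.moveUnary hab n r _ h

theorem copy_one (hab : a ≠ b) (hat : a ≠ d) (hbt : b ≠ d) (h : s.get a = l)
    (ht : s.get d = []) :
    Ex (Cmd.copy 1 a b d : Cmd Reg F) s (s.set b (l ++ s.get b)) (5 * l.length + 2) := by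
  subst h
  rw [Ex, St.get_set]
  refine (Runs.copy hab hat hbt 1 _ ht).congr rfl ?_ le_rfl
  have : (List.replicate 1 : Bool → List Bool) = fun x => [x] := rfl
  rw [this, List.flatMap_singleton']

theorem copy_unary (hab : a ≠ b) (hat : a ≠ d) (hbt : b ≠ d) {c : ℕ}
    (h : s.get a = List.replicate n true) (ht : s.get d = []) :
    Ex (Cmd.copy c a b d : Cmd Reg F) s
      (s.set b (List.replicate (c * n) true ++ s.get b)) ((c + 4) * n + 2) := by
  rw [Ex, St.get_set]
  refine (Runs.copy hab hat hbt c _ ht).congr rfl ?_ (by rw [h, List.length_replicate])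
  rw [h]
  congr 2
  rw [List.eq_replicate_iff]
  refine ⟨by simp [List.length_flatMap, Nat.mul_comm], fun x hx => ?_⟩
  simp only [List.mem_flatMap, List.mem_replicate] at hx
  obtain ⟨y, hy, hx⟩ := hx
  exact hx.2.trans hy.2

theorem call {j : J} {l' : List Bool} (hab : a ≠ b) (hl : s.get a = l.reverse)
    (h : (F j).OutputsWithin l l' t) :
    Ex (Cmd.call j a b : Cmd Reg F) s ((s.set a []).set b (l'.reverse ++ s.get b))
      (t + l.length + l'.length + 2) := by
  rw [Ex, St.get_set, St.get_set]
  refine (Runs.call hl h).congr rfl ?_ le_rfl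
  rw [update_of_ne hab.symm]

theorem move_seq (hab : a ≠ b)
    (h : Ex Q ((s.set a []).set b ((s.get a).reverse ++ s.get b)) s' t) :
    Ex (Cmd.move a b ;; Q) s s' (2 * (s.get a).length + 1 + t) := (Ex.move hab rfl).seq h

theorem clear_seq (h : Ex Q (s.set a []) s' t) :
    Ex (Cmd.clear a ;; Q) s s' ((s.get a).length + 1 + t) := (Ex.clear rfl).seq h

end Ex

end Rules

/-! ### Computing the adjacency matrix -/

section Matrix

variable {J : Type} {F : J → Machine} [DecidableEq J]

/-- The pairs of a list, each preceded by `true`. -/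
def recordBody : List (Bool × Bool) → List Bool
  | [] => []
  | q :: c => true :: q.1 :: q.2 :: recordBody c

/-- The code of a list of lists of pairs of bits. -/
def records : List (List (Bool × Bool)) → List Bool
  | [] => []
  | c :: cs => true :: (recordBody c ++ false :: records cs)

/-- The components of a list of pairs. -/
def flatPairs : List (Bool × Bool) → List Bool
  | [] => []
  | q :: c => q.1 :: q.2 :: flatPairs c

/-- The number of positions at which one of the lists contains `true` as first component, and the
other one as second component. -/
def clashCount : List (Bool × Bool) → List (Bool × Bool) → ℕ
  | q :: c, q' :: d => (if q.1 && q'.2 || q.2 && q'.1 then 1 else 0) + clashCount c d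
  | _, _ => 0

/-- The entries of a row of the matrix: whether the lists `c` and `d` clash, for the lists `d` of
the third argument; but `false` at places where the second argument is `false`. -/
def rowBits (c : List (Bool × Bool)) : List Bool → List (List (Bool × Bool)) → List Bool
  | _, [] => []
  | D, d :: ds => (D.head?.getD true && decide (0 < clashCount c d)) :: rowBits c D.tail ds

/-- The rows of the matrix that belong to the lists of the second argument, the first of which is
row number `i`. -/
def matrixBits : ℕ → List (List (Bool × Bool)) → List (List (Bool × Bool)) → List Bool
  | _, [], _ => []
  | i, c :: cs, ds => rowBits c (List.replicate i true ++ [false]) ds ++ matrixBits (i + 1) cs ds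

theorem clashCount_le (c d : List (Bool × Bool)) : clashCount c d ≤ d.length := by
  induction d generalizing c with
  | nil => cases c <;> simp [clashCount]
  | cons q d ih =>
    rcases c with _ | ⟨q', c⟩
    · simp [clashCount]
    · have := ih c
      simp only [clashCount, List.length_cons]
      split <;> omega

theorem length_recordBody (c : List (Bool × Bool)) : (recordBody c).length = 3 * c.length := by
  induction c with
  | nil => rfl
  | cons q c ih => simp only [recordBody, List.length_cons, ih]; omega

theorem length_flatPairs (c : List (Bool × Bool)) : (flatPairs c).length = 2 * c.length := by
  induction c with
  | nil => rfl
  | cons q c ih => simp only [flatPairs, List.length_cons, ih]; omega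

theorem length_records {W : ℕ} {cs : List (List (Bool × Bool))} (h : ∀ c ∈ cs, c.length = W) :
    (records cs).length = cs.length * (3 * W + 2) := by
  induction cs with
  | nil => simp [records]
  | cons c cs ih =>
    simp only [records, List.length_cons, List.length_append, length_recordBody,
      h c (by simp), ih fun d hd => h d (by simp [hd])]
    ring

namespace Cmd

/-- Compare the row in register `aa` with a column that is read from register `x2`. -/
def zipColumn : Cmd Reg F :=
  loop .x2 id fun _ => push .x3 true ;; cases .x2 fun t' => cases .x2 fun f' =>
    cases .aa fun t => cases .aa fun f =>
      push .x3 (t'.getD false) ;; push .x3 (f'.getD false) ;;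
      push .ab (t.getD false) ;; push .ab (f.getD false) ;;
      when (t.getD false && f'.getD false || f.getD false && t'.getD false) (push .fl true)

/-- Write an entry of the matrix: whether register `fl` is nonempty, unless register `de` starts
with `false`. -/
def writeEntry : Cmd Reg F :=
  cases .de (fun o => if o.getD true then cases .fl (fun o' => push .yy (o'.getD false))
    else push .yy false) ;; clear .fl

/-- Write a row of the matrix. -/
def writeRow : Cmd Reg F :=
  loop .x2 id fun _ => push .x3 true ;; zipColumn ;; push .x3 false ;; move .ab .aa ;; writeEntry

/-- Write all rows of the matrix. -/
def writeRows : Cmd Reg F :=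
  loop .x1 id fun _ =>
    loop .x1 id (fun _ => cases .x1 fun t => cases .x1 fun f =>
      push .ab (t.getD false) ;; push .ab (f.getD false)) ;;
    move .ab .aa ;; copy 1 .dg .de .tmp ;; writeRow ;; move .x3 .x2 ;; clear .aa ;; clear .de ;;
    push .dg true

end Cmd

open Cmd

/-- The number of clashes is added to `fl` in unary. The column is moved to `x3`, and the row to
`ab`, both backwards. -/
theorem ex_zipColumn (c d : List (Bool × Bool)) (hcd : c.length = d.length) (s : St)
    (R X A N : List Bool) :
    Ex (zipColumn : Cmd Reg F)
      { s with x2 := recordBody d ++ false :: R, x3 := X, aa := flatPairs c, ab := A, fl := N }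
      { s with x2 := R, x3 := (recordBody d).reverse ++ X, aa := [],
               ab := (flatPairs c).reverse ++ A,
               fl := List.replicate (clashCount c d) true ++ N } (11 * d.length + 1) := by
  induction d generalizing c X A N with
  | nil =>
    obtain rfl : c = [] := by simpa using hcd
    exact Ex.loop_stop rfl rfl
  | cons q' d ih =>
    rcases c with _ | ⟨q, c⟩
    · simp at hcd
    rcases q with ⟨t, f⟩
    rcases q' with ⟨t', f'⟩
    have h1 : (recordBody ((t', f') :: d)).reverse ++ X =
      (recordBody d).reverse ++ (f' :: t' :: true :: X) := by simp [recordBody]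
    have h2 : (flatPairs ((t, f) :: c)).reverse ++ A =
      (flatPairs c).reverse ++ (f :: t :: A) := by simp [flatPairs]
    have h3 : List.replicate (clashCount ((t, f) :: c) ((t', f') :: d)) true ++ N =
      List.replicate (clashCount c d) true ++ (if t && f' || f && t' then true :: N else N) := by
      simp only [clashCount]
      split
      · rw [Nat.add_comm, List.replicate_succ']; simp
      · simp
    rw [h1, h2, h3]
    apply Ex.loop_cons_le (h₂ := ih c (by simpa using hcd)
      (f' :: t' :: true :: X) (f :: t :: A) (if t && f' || f && t' then true :: N else N))
    case h => rfl
    case hb => rfl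
    case h₁ =>
      apply Ex.push_seq
      dsimp only [St.set, St.get]
      apply Ex.cases_some
      · rfl
      dsimp only [St.set, St.get]
      apply Ex.cases_some
      · rfl
      dsimp only [St.set, St.get]
      apply Ex.cases_some
      · rfl
      dsimp only [St.set, St.get]
      apply Ex.cases_some
      · rfl
      dsimp only [St.set, St.get]
      apply Ex.push_seq
      dsimp only [St.set, St.get]
      apply Ex.push_seq
      dsimp only [St.set, St.get]
      apply Ex.push_seq
      dsimp only [St.set, St.get]
      apply Ex.push_seq
      dsimp only [St.set, St.get]
      exact Ex.when_push _ _ _ _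
    case hv =>
      simp only [List.length_cons]
      omega

theorem ex_writeEntry (s : St) (D Y : List Bool) (n : ℕ) :
    Ex (writeEntry : Cmd Reg F) { s with de := D, fl := List.replicate n true, yy := Y }
      { s with de := D.tail, fl := [], yy := (D.head?.getD true && decide (0 < n)) :: Y }
      (n + 4) := by
  have h1 : Ex (Cmd.cases .fl (fun o' => push .yy (o'.getD false)) : Cmd Reg F)
      { s with de := D.tail, fl := List.replicate n true, yy := Y }
      { s with de := D.tail, fl := List.replicate (n - 1) true, yy := decide (0 < n) :: Y } 2 := by
    rcases n with _ | n
    · exact Ex.cases_none rfl (Ex.push _ _ _)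
    · apply Ex.cases_some
      · rfl
      dsimp only [St.set, St.get]
      rw [decide_eq_true (Nat.succ_pos n)]
      exact Ex.push _ _ _
  have h2 : Ex (Cmd.cases .de (fun o => if o.getD true then
        cases .fl (fun o' => push .yy (o'.getD false)) else push .yy false) : Cmd Reg F)
      { s with de := D, fl := List.replicate n true, yy := Y }
      { s with de := D.tail,
               fl := List.replicate (if D.head?.getD true then n - 1 else n) true,
               yy := (D.head?.getD true && decide (0 < n)) :: Y } 3 := by
    rcases D with _ | ⟨_ | _, D⟩
    · exact Ex.cases_none rfl h1
    · refine (Ex.cases_some rfl ?_).mono (show 1 + 1 ≤ 3 by omega)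
      dsimp only [St.set, St.get]
      exact Ex.push _ _ _
    · exact Ex.cases_some rfl h1
  have h3 := h2.seq (Ex.clear (a := .fl) rfl)
  refine h3.mono ?_
  simp only [St.get, List.length_replicate]
  split <;> omega

/-- Comparing a row with all columns leaves the row in place, and the columns backwards in `x3`. -/
theorem ex_writeRow {W : ℕ} (c : List (Bool × Bool)) (hc : c.length = W)
    (ds : List (List (Bool × Bool))) (hds : ∀ d ∈ ds, d.length = W) (s : St) (X D Y : List Bool) :
    Ex (writeRow : Cmd Reg F)
      { s with x2 := records ds, x3 := X, aa := flatPairs c, ab := [], de := D, fl := [], yy := Y }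
      { s with x2 := [], x3 := (records ds).reverse ++ X, aa := flatPairs c, ab := [],
               de := D.drop ds.length, fl := [], yy := (rowBits c D ds).reverse ++ Y }
      (ds.length * (16 * W + 10) + 1) := by
  induction ds generalizing X D Y with
  | nil => exact Ex.loop_nil_le rfl (by simp)
  | cons d ds ih =>
    have hd : d.length = W := hds d (by simp)
    have h1 : (records (d :: ds)).reverse ++ X =
      (records ds).reverse ++ (false :: ((recordBody d).reverse ++ (true :: X))) := by
      simp [records]
    have h2 : (rowBits c D (d :: ds)).reverse ++ Y = (rowBits c D.tail ds).reverse ++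
        ((D.head?.getD true && decide (0 < clashCount c d)) :: Y) := by
      simp [rowBits]
    have h3 : D.drop (d :: ds).length = D.tail.drop ds.length := by simp
    rw [h1, h2, h3]
    apply Ex.loop_cons_le (h₂ := ih (fun d hd => hds d (by simp [hd])) _ _ _)
    case h => rfl
    case hb => rfl
    case h₁ =>
      apply Ex.push_seq
      dsimp only [St.set, St.get]
      apply Ex.seq
      · exact ex_zipColumn (F := F) c d (hc.trans hd.symm)
          { s with de := D, yy := Y } (records ds) _ _ _
      dsimp only [St.set, St.get]
      apply Ex.push_seq
      dsimp only [St.set, St.get]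
      apply Ex.move_seq (by decide)
      dsimp only [St.set, St.get]
      simp only [List.append_nil, List.reverse_reverse]
      exact ex_writeEntry (F := F)
        { s with x2 := records ds, x3 := false :: ((recordBody d).reverse ++ (true :: X)),
                 aa := flatPairs c, ab := [] } _ _ _
    case hv =>
      have := clashCount_le c d
      simp only [St.get, List.append_nil, List.length_cons, List.length_reverse, length_flatPairs,
        hd,        hc] at this ⊢
      ring_nf
      omega

theorem ex_readRow (c : List (Bool × Bool)) (s : St) (R A : List Bool) :
    Ex (loop .x1 id (fun _ => cases .x1 fun t => cases .x1 fun f =>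
        push .ab (t.getD false) ;; push .ab (f.getD false)) : Cmd Reg F)
      { s with x1 := recordBody c ++ false :: R, ab := A }
      { s with x1 := R, ab := (flatPairs c).reverse ++ A } (5 * c.length + 1) := by
  induction c generalizing A with
  | nil => exact Ex.loop_stop rfl rfl
  | cons q c ih =>
    rcases q with ⟨t, f⟩
    have h2 : (flatPairs ((t, f) :: c)).reverse ++ A =
      (flatPairs c).reverse ++ (f :: t :: A) := by simp [flatPairs]
    rw [h2]
    apply Ex.loop_cons_le (h₂ := ih (f :: t :: A))
    case h => rfl
    case hb => rfl
    case h₁ =>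
      apply Ex.cases_some
      · rfl
      dsimp only [St.set, St.get]
      apply Ex.cases_some
      · rfl
      dsimp only [St.set, St.get]
      apply Ex.push_seq
      dsimp only [St.set, St.get]
      exact Ex.push _ _ _
    case hv =>
      simp only [List.length_cons]
      omega

/-- The word `dg` is the number of the present row in unary. It locates the diagonal, whose entries
are `false` although vertices may carry opposite tokens. -/
theorem ex_writeRows {W N : ℕ} (ds : List (List (Bool × Bool))) (hN : ds.length = N)
    (hds : ∀ d ∈ ds, d.length = W) (cs : List (List (Bool × Bool))) (hcs : ∀ c ∈ cs, c.length = W)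
    (i : ℕ) (hi : i + cs.length ≤ N) (s : St) (Y : List Bool) :
    Ex (writeRows : Cmd Reg F)
      { s with tmp := [], fl := [], x1 := records cs, x2 := records ds, x3 := [], aa := [],
               ab := [], dg := List.replicate i true ++ [false], de := [], yy := Y }
      { s with tmp := [], fl := [], x1 := [], x2 := records ds, x3 := [], aa := [],
               ab := [], dg := List.replicate (i + cs.length) true ++ [false], de := [],
               yy := (matrixBits i cs ds).reverse ++ Y }
      (cs.length * ((N + 1) * (40 * W + 40)) + 1) := by
  induction cs generalizing i Y with
  | nil => exact Ex.loop_nil_le rfl (by simp)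
  | cons c cs ih =>
    have hc : c.length = W := hcs c (by simp)
    have h1 : (matrixBits i (c :: cs) ds).reverse ++ Y = (matrixBits (i + 1) cs ds).reverse ++
        ((rowBits c (List.replicate i true ++ [false]) ds).reverse ++ Y) := by
      simp [matrixBits]
    have h2 : i + (c :: cs).length = (i + 1) + cs.length := by simp; omega
    rw [h2] at hi
    rw [h1, h2]
    apply Ex.loop_cons_le (h₂ := ih (fun d hd => hcs d (by simp [hd])) (i + 1) hi _)
    case h => rfl
    case hb => rfl
    case h₁ =>
      apply Ex.seq
      · exact ex_readRow (F := F) c _ (records cs) _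
      dsimp only [St.set, St.get]
      apply Ex.move_seq (by decide)
      dsimp only [St.set, St.get]
      apply Ex.seq
      · exact Ex.copy_one (by decide) (by decide) (by decide) rfl rfl
      dsimp only [St.set, St.get]
      simp only [List.append_nil, List.reverse_reverse]
      apply Ex.seq
      · exact ex_writeRow (F := F) c hc ds hds
          { s with tmp := [], x1 := records cs, dg := List.replicate i true ++ [false] } _ _ _
      dsimp only [St.set, St.get]
      apply Ex.move_seq (by decide)
      dsimp only [St.set, St.get]
      simp only [List.append_nil, List.reverse_reverse]
      apply Ex.clear_seq
      dsimp only [St.set, St.get]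
      apply Ex.clear_seq
      dsimp only [St.set, St.get]
      exact Ex.push _ _ _
    case hv =>
      have hl := length_records hds
      simp only [St.get, List.length_cons, List.length_append, List.length_replicate,
        List.length_nil, List.length_reverse, length_flatPairs, hc, hl,
        List.length_drop, hN, List.append_nil]
      have : i + 1 ≤ N := by omega
      have h3 : i + (0 + 1) - N = 0 := by omega
      rw [h3]
      nlinarith [Nat.zero_le (N * W)]

end Matrix

/-! ### Parsing the formula -/

section Parse

variable {J : Type} {F : J → Machine} [DecidableEq J]

/-- The code of a literal. -/
def litCode (l : ℕ × Bool) : List Bool := l.2 :: (List.replicate l.1 true ++ [false])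

/-- The code of a clause. -/
def clauseCode (c : Fin 3 → ℕ × Bool) : List Bool :=
  litCode (c 0) ++ litCode (c 1) ++ litCode (c 2)

/-- The code of a list of clauses. -/
def clausesCode (cs : List (Fin 3 → ℕ × Bool)) : List Bool := cs.flatMap clauseCode

theorem length_clauseCode (c : Fin 3 → ℕ × Bool) :
    (clauseCode c).length = (c 0).1 + (c 1).1 + (c 2).1 + 6 := by
  simp only [clauseCode, litCode, List.length_append, List.length_cons, List.length_replicate,
    List.length_nil]
  omega

theorem clausesCode_cons (c : Fin 3 → ℕ × Bool) (cs : List (Fin 3 → ℕ × Bool)) :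
    clausesCode (c :: cs) = (c 0).2 :: (List.replicate (c 0).1 true ++ false ::
      ((c 1).2 :: (List.replicate (c 1).1 true ++ false ::
        ((c 2).2 :: (List.replicate (c 2).1 true ++ false :: clausesCode cs))))) := by
  simp [clausesCode, clauseCode, litCode]

theorem length_clausesCode_cons (c : Fin 3 → ℕ × Bool) (cs : List (Fin 3 → ℕ × Bool)) :
    (clausesCode (c :: cs)).length =
      (c 0).1 + (c 1).1 + (c 2).1 + 6 + (clausesCode cs).length := by
  simp [clausesCode, length_clauseCode]

namespace Cmd

/-- Read the clauses, copy them to register `tmp`, and count them. -/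
def readClauses : Cmd Reg F :=
  loop .inp (fun _ => true) fun b => push .tmp b ;; moveUnary .inp .tmp ;; push .tmp false ;;
    cases .inp fun b => push .tmp (b.getD false) ;; moveUnary .inp .tmp ;; push .tmp false ;;
      cases .inp fun b => push .tmp (b.getD false) ;; moveUnary .inp .tmp ;; push .tmp false ;;
        push .mc true

end Cmd

open Cmd

theorem ex_readClauses (cs : List (Fin 3 → ℕ × Bool)) (s : St) (A M : List Bool) :
    Ex (readClauses : Cmd Reg F) { s with inp := clausesCode cs, tmp := A, mc := M }
      { s with inp := [], tmp := (clausesCode cs).reverse ++ A,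
               mc := List.replicate cs.length true ++ M }
      (3 * (clausesCode cs).length + 1) := by
  induction cs generalizing A M with
  | nil => exact Ex.loop_nil rfl
  | cons c cs ih =>
    have h1 : (clausesCode (c :: cs)).reverse ++ A = (clausesCode cs).reverse ++
      (false :: (List.replicate (c 2).1 true ++ (c 2).2 :: (false ::
        (List.replicate (c 1).1 true ++ (c 1).2 :: (false ::
          (List.replicate (c 0).1 true ++ (c 0).2 :: A)))))) := by
      simp [clausesCode_cons]
    have h2 : List.replicate (c :: cs).length true ++ M =
      List.replicate cs.length true ++ true :: M := by
      rw [List.length_cons, List.replicate_succ']; simp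
    rw [h1, h2, length_clausesCode_cons, clausesCode_cons]
    apply Ex.loop_cons_le (h₂ := ih _ _)
    case h => rfl
    case hb => rfl
    case h₁ =>
      apply Ex.push_seq
      dsimp only [St.set, St.get]
      apply Ex.seq
      · exact Ex.moveUnary (by decide) rfl
      dsimp only [St.set, St.get]
      apply Ex.push_seq
      dsimp only [St.set, St.get]
      apply Ex.cases_some
      · rfl
      dsimp only [St.set, St.get]
      apply Ex.push_seq
      dsimp only [St.set, St.get]
      apply Ex.seq
      · exact Ex.moveUnary (by decide) rfl
      dsimp only [St.set, St.get]
      apply Ex.push_seq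
      dsimp only [St.set, St.get]
      apply Ex.cases_some
      · rfl
      dsimp only [St.set, St.get]
      apply Ex.push_seq
      dsimp only [St.set, St.get]
      apply Ex.seq
      · exact Ex.moveUnary (by decide) rfl
      dsimp only [St.set, St.get]
      apply Ex.push_seq
      dsimp only [St.set, St.get]
      exact Ex.push _ _ _
    case hv => omega

end Parse

/-! ### The records of the vertices -/

section Records

variable {J : Type} {F : J → Machine} [DecidableEq J]

/-- Which of the words in `D`, of the form `1…10`, are about to end, for the first `w` steps of
reading all of them simultaneously: whether this holds for one of the words with sign `true`, and
for one of the words with sign `false`. -/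
def tokenPairs (b₀ b₁ b₂ : Bool) : ℕ → List Bool → List Bool → List Bool → List Bool → List Bool →
    List (Bool × Bool)
  | 0, _, _, _, _, _ => []
  | w + 1, D₀, D₁, D₂, D₃, D₄ =>
    ((D₀.head? == some false && b₀ || D₁.head? == some false && b₁ ||
        D₂.head? == some false && b₂ || D₃.head? == some false),
      (D₀.head? == some false && !b₀ || D₁.head? == some false && !b₁ ||
        D₂.head? == some false && !b₂ || D₄.head? == some false)) ::
      tokenPairs b₀ b₁ b₂ w D₀.tail D₁.tail D₂.tail D₃.tail D₄.tail

/-- The list of tokens of a vertex, as pairs of bits for each `j < W`: whether `(j, true)` is a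
token, and whether `(j, false)` is. Here `n` are the variables of the clause, `b` are the values
of these variables, and `q` is the number that belongs to the position. -/
def vertexRecord (W : ℕ) (n : Fin 3 → ℕ) (b : Fin 3 → Bool) (q : ℕ) : List (Bool × Bool) :=
  (List.range W).map fun j =>
    ((decide (j = n 0) && b 0 || decide (j = n 1) && b 1 || decide (j = n 2) && b 2 ||
        decide (j = q)),
      (decide (j = n 0) && !b 0 || decide (j = n 1) && !b 1 || decide (j = n 2) && !b 2 ||
        decide (j = q + 1)))

theorem length_vertexRecord (W : ℕ) (n : Fin 3 → ℕ) (b : Fin 3 → Bool) (q : ℕ) :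
    (vertexRecord W n b q).length = W := by simp [vertexRecord]

theorem head?_drop_unary (n i : ℕ) :
    (((List.replicate n true ++ [false]).drop i).head? == some false) = decide (i = n) := by
  rw [List.head?_drop]
  rcases lt_trichotomy i n with h | rfl | h
  · rw [List.getElem?_append_left (by simpa using h)]
    simp [h, h.ne]
  · simp
  · rw [List.getElem?_eq_none (by simpa using h)]
    simp [h.ne']

theorem tokenPairs_eq (b₀ b₁ b₂ : Bool) (n₀ n₁ n₂ n₃ n₄ w i : ℕ) :
    tokenPairs b₀ b₁ b₂ w ((List.replicate n₀ true ++ [false]).drop i)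
      ((List.replicate n₁ true ++ [false]).drop i) ((List.replicate n₂ true ++ [false]).drop i)
      ((List.replicate n₃ true ++ [false]).drop i) ((List.replicate n₄ true ++ [false]).drop i) =
    (List.range' i w).map fun j =>
      ((decide (j = n₀) && b₀ || decide (j = n₁) && b₁ || decide (j = n₂) && b₂ ||
          decide (j = n₃)),
        (decide (j = n₀) && !b₀ || decide (j = n₁) && !b₁ || decide (j = n₂) && !b₂ ||
          decide (j = n₄))) := by
  induction w generalizing i with
  | zero => rfl
  | succ w ih =>
    simp only [tokenPairs, head?_drop_unary, List.tail_drop, ih (i + 1), List.range'_succ,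
      List.map_cons]

theorem vertexRecord_eq (W : ℕ) (n : Fin 3 → ℕ) (b : Fin 3 → Bool) (q : ℕ) :
    tokenPairs (b 0) (b 1) (b 2) W (List.replicate (n 0) true ++ [false])
      (List.replicate (n 1) true ++ [false]) (List.replicate (n 2) true ++ [false])
      (List.replicate q true ++ [false]) (List.replicate (q + 1) true ++ [false]) =
    vertexRecord W n b q := by
  have := tokenPairs_eq (b 0) (b 1) (b 2) (n 0) (n 1) (n 2) q (q + 1) W 0
  rw [← List.range_eq_range'] at this
  exact this

namespace Cmd

/-- Write the body of a record. -/
def writePairs (b₀ b₁ b₂ : Bool) : Cmd Reg F :=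
  loop .cw (fun _ => true) fun _ => push .xx true ;;
    cases .c0 fun o₀ => cases .c1 fun o₁ => cases .c2 fun o₂ => cases .c3 fun o₃ =>
      cases .c4 fun o₄ =>
        push .xx (o₀ == some false && b₀ || o₁ == some false && b₁ ||
          o₂ == some false && b₂ || o₃ == some false) ;;
        push .xx (o₀ == some false && !b₀ || o₁ == some false && !b₁ ||
          o₂ == some false && !b₂ || o₄ == some false)

/-- Write the record of a vertex. -/
def writeRecord (b₀ b₁ b₂ : Bool) : Cmd Reg F :=
  copy 1 .u0 .c0 .tmp ;; copy 1 .u1 .c1 .tmp ;; copy 1 .u2 .c2 .tmp ;; copy 1 .po .c3 .tmp ;;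
    copy 1 .po .c4 .tmp ;; push .c4 true ;; copy 1 .wc .cw .tmp ;; push .xx true ;;
    writePairs b₀ b₁ b₂ ;; push .xx false

/-- Write the records of the vertices of a position that belong to the numbers of the list, for
a clause with signs `s₀`, `s₁`, `s₂`. -/
def writeRecords (s₀ s₁ s₂ : Bool) : List ℕ → Cmd Reg F
  | [] => skip
  | e :: es => writeRecord (s₀ == (e + 1).testBit 0) (s₁ == (e + 1).testBit 1)
      (s₂ == (e + 1).testBit 2) ;; writeRecords s₀ s₁ s₂ es

end Cmd

open Cmd

theorem ex_writePairs (b₀ b₁ b₂ : Bool) (w : ℕ) (s : St) (D₀ D₁ D₂ D₃ D₄ X : List Bool) :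
    Ex (writePairs b₀ b₁ b₂ : Cmd Reg F)
      { s with cw := List.replicate w true, c0 := D₀, c1 := D₁, c2 := D₂, c3 := D₃, c4 := D₄,
               xx := X }
      { s with cw := [], c0 := D₀.drop w, c1 := D₁.drop w, c2 := D₂.drop w, c3 := D₃.drop w,
               c4 := D₄.drop w,
               xx := (recordBody (tokenPairs b₀ b₁ b₂ w D₀ D₁ D₂ D₃ D₄)).reverse ++ X }
      (9 * w + 1) := by
  induction w generalizing D₀ D₁ D₂ D₃ D₄ X with
  | zero => exact Ex.loop_nil rfl
  | succ w ih =>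
    simp only [tokenPairs, recordBody, List.reverse_cons, List.append_assoc, List.cons_append,
      List.nil_append, ← List.drop_tail, List.replicate_succ]
    apply Ex.loop_cons_le (h₂ := ih _ _ _ _ _ _)
    case h => rfl
    case hb => rfl
    case h₁ =>
      apply Ex.push_seq
      dsimp only [St.set, St.get]
      apply Ex.cases_head
      dsimp only [St.set, St.get]
      apply Ex.cases_head
      dsimp only [St.set, St.get]
      apply Ex.cases_head
      dsimp only [St.set, St.get]
      apply Ex.cases_head
      dsimp only [St.set, St.get]
      apply Ex.cases_head
      dsimp only [St.set, St.get]
      apply Ex.push_seq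
      dsimp only [St.set, St.get]
      exact Ex.push _ _ _
    case hv => omega

theorem ex_writeRecord {W q : ℕ} {n : Fin 3 → ℕ} (hn : ∀ a, n a < W) (hq : q + 1 < W)
    (b : Fin 3 → Bool) (s : St) (X : List Bool) :
    Ex (writeRecord (b 0) (b 1) (b 2) : Cmd Reg F)
      { s with u0 := List.replicate (n 0) true ++ [false],
               u1 := List.replicate (n 1) true ++ [false],
               u2 := List.replicate (n 2) true ++ [false],
               po := List.replicate q true ++ [false], wc := List.replicate W true,
               c0 := [], c1 := [], c2 := [], c3 := [], c4 := [], cw := [], tmp := [], xx := X }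
      { s with u0 := List.replicate (n 0) true ++ [false],
               u1 := List.replicate (n 1) true ++ [false],
               u2 := List.replicate (n 2) true ++ [false],
               po := List.replicate q true ++ [false], wc := List.replicate W true,
               c0 := [], c1 := [], c2 := [], c3 := [], c4 := [], cw := [], tmp := [],
               xx := false :: ((recordBody (vertexRecord W n b q)).reverse ++ true :: X) }
      (40 * W + 20) := by
  apply Ex.mono
  case h =>
    apply Ex.seq
    · exact Ex.copy_one (by decide) (by decide) (by decide) rfl rfl
    dsimp only [St.set, St.get]
    apply Ex.seq
    · exact Ex.copy_one (by decide) (by decide) (by decide) rfl rfl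
    dsimp only [St.set, St.get]
    apply Ex.seq
    · exact Ex.copy_one (by decide) (by decide) (by decide) rfl rfl
    dsimp only [St.set, St.get]
    apply Ex.seq
    · exact Ex.copy_one (by decide) (by decide) (by decide) rfl rfl
    dsimp only [St.set, St.get]
    apply Ex.seq
    · exact Ex.copy_one (by decide) (by decide) (by decide) rfl rfl
    dsimp only [St.set, St.get]
    apply Ex.push_seq
    dsimp only [St.set, St.get]
    apply Ex.seq
    · exact Ex.copy_one (by decide) (by decide) (by decide) rfl rfl
    dsimp only [St.set, St.get]
    apply Ex.push_seq
    dsimp only [St.set, St.get]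
    simp only [List.append_nil]
    apply Ex.seq
    · exact ex_writePairs (F := F) (b 0) (b 1) (b 2) W
        { s with u0 := List.replicate (n 0) true ++ [false],
                 u1 := List.replicate (n 1) true ++ [false],
                 u2 := List.replicate (n 2) true ++ [false],
                 po := List.replicate q true ++ [false], wc := List.replicate W true, tmp := [] }
        _ _ _ _ _ _
    dsimp only [St.set, St.get]
    have h (k : ℕ) (hk : k < W) : (List.replicate k true ++ [false]).drop W = [] := by
      simp; omega
    have h' : (true :: (List.replicate q true ++ [false])).drop W = [] := by
      simp; omega
    have h3 := vertexRecord_eq W n b q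
    rw [List.replicate_succ, List.cons_append] at h3
    rw [h _ (hn 0), h _ (hn 1), h _ (hn 2), h q (by omega), h', h3]
    exact Ex.push _ _ _
  case htu =>
    have h0 := hn 0
    have h1 := hn 1
    have h2 := hn 2
    simp only [St.get, List.length_append, List.length_replicate, List.length_cons,
      List.length_nil]
    omega

/-- The value that the vertex number `e` of a position gives to the variable of literal number `a`,
if the sign of the literal is `s`. The binary digits of `e + 1` tell which of the three literals
are true at the vertex. -/
def maskValue (e : ℕ) (s : Bool) (a : Fin 3) : Bool := s == (e + 1).testBit a

theorem ex_writeRecords {W q : ℕ} {c : Fin 3 → ℕ × Bool} (hn : ∀ a, (c a).1 < W) (hq : q + 1 < W)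
    (es : List ℕ) (s : St) (X : List Bool) :
    Ex (writeRecords (c 0).2 (c 1).2 (c 2).2 es : Cmd Reg F)
      { s with u0 := List.replicate (c 0).1 true ++ [false],
               u1 := List.replicate (c 1).1 true ++ [false],
               u2 := List.replicate (c 2).1 true ++ [false],
               po := List.replicate q true ++ [false], wc := List.replicate W true,
               c0 := [], c1 := [], c2 := [], c3 := [], c4 := [], cw := [], tmp := [], xx := X }
      { s with u0 := List.replicate (c 0).1 true ++ [false],
               u1 := List.replicate (c 1).1 true ++ [false],
               u2 := List.replicate (c 2).1 true ++ [false],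
               po := List.replicate q true ++ [false], wc := List.replicate W true,
               c0 := [], c1 := [], c2 := [], c3 := [], c4 := [], cw := [], tmp := [],
               xx := (records (es.map fun e => vertexRecord W (fun a => (c a).1)
                 (fun a => maskValue e (c a).2 a) q)).reverse ++ X }
      (es.length * (40 * W + 20)) := by
  induction es generalizing X with
  | nil =>
    simp only [List.length_nil, Nat.zero_mul]
    exact Ex.skip _
  | cons e es ih =>
    simp only [List.map_cons, records, List.reverse_cons, List.reverse_append, List.append_assoc,
      List.cons_append, List.nil_append]
    apply Ex.mono
    case h =>
      apply Ex.seq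
      · exact ex_writeRecord (F := F) (n := fun a => (c a).1) hn hq
          (fun a => maskValue e (c a).2 a) s X
      exact ih _
    case htu =>
      simp only [List.length_cons]
      ring_nf
      omega

namespace Cmd

/-- Write the records of the vertices of a position. The clause of the position is read from
register `rr`, where it starts with the sign `s₀`. -/
def writeClauseRecords (s₀ : Option Bool) : Cmd Reg F :=
  push .u0 false ;; moveUnary .rr .u0 ;; cases .rr fun s₁ =>
    push .u1 false ;; moveUnary .rr .u1 ;; cases .rr fun s₂ =>
      push .u2 false ;; moveUnary .rr .u2 ;;
      writeRecords (s₀.getD false) (s₁.getD false) (s₂.getD false) (List.range 7) ;;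
      clear .u0 ;; clear .u1 ;; clear .u2 ;; push .po true

/-- Write the records of the vertices of a position. If all clauses have been used up, start again
with the first one. -/
def writePosition : Cmd Reg F :=
  cases .rr (fun o => match o with
    | none => copy 1 .cl .rr .tmp
    | some b => push .rr b) ;;
  cases .rr writeClauseRecords

/-- Write the records of all vertices. -/
def writePositions : Cmd Reg F := loop .tc (fun _ => true) fun _ => writePosition

end Cmd

open Cmd

/-- The list of records of the vertices of a position with clause `c` and number `q`. -/
def clauseRecords (W : ℕ) (c : Fin 3 → ℕ × Bool) (q : ℕ) : List (List (Bool × Bool)) :=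
  (List.range 7).map fun e =>
    vertexRecord W (fun a => (c a).1) (fun a => maskValue e (c a).2 a) q

theorem ex_writeClauseRecords {W q : ℕ} {c : Fin 3 → ℕ × Bool} (hn : ∀ a, (c a).1 < W)
    (hq : q + 1 < W) (s : St) (R X : List Bool) :
    Ex (cases .rr writeClauseRecords : Cmd Reg F)
      { s with rr := clauseCode c ++ R, u0 := [], u1 := [], u2 := [],
               po := List.replicate q true ++ [false], wc := List.replicate W true,
               c0 := [], c1 := [], c2 := [], c3 := [], c4 := [], cw := [], tmp := [], xx := X }
      { s with rr := R, u0 := [], u1 := [], u2 := [],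
               po := List.replicate (q + 1) true ++ [false], wc := List.replicate W true,
               c0 := [], c1 := [], c2 := [], c3 := [], c4 := [], cw := [], tmp := [],
               xx := (records (clauseRecords W c q)).reverse ++ X }
      (290 * W + 170) := by
  have hR : clauseCode c ++ R = (c 0).2 :: (List.replicate (c 0).1 true ++ false ::
      ((c 1).2 :: (List.replicate (c 1).1 true ++ false ::
        ((c 2).2 :: (List.replicate (c 2).1 true ++ false :: R))))) := by
    simp [clauseCode, litCode]
  rw [hR]
  apply Ex.mono
  case h =>
    apply Ex.cases_some
    · rfl
    dsimp only [St.set, St.get]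
    apply Ex.push_seq
    dsimp only [St.set, St.get]
    apply Ex.seq
    · exact Ex.moveUnary (by decide) rfl
    dsimp only [St.set, St.get]
    apply Ex.cases_some
    · rfl
    dsimp only [St.set, St.get]
    apply Ex.push_seq
    dsimp only [St.set, St.get]
    apply Ex.seq
    · exact Ex.moveUnary (by decide) rfl
    dsimp only [St.set, St.get]
    apply Ex.cases_some
    · rfl
    dsimp only [St.set, St.get]
    apply Ex.push_seq
    dsimp only [St.set, St.get]
    apply Ex.seq
    · exact Ex.moveUnary (by decide) rfl
    dsimp only [St.set, St.get]
    apply Ex.seq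
    · exact ex_writeRecords (F := F) hn hq (List.range 7) { s with rr := R } X
    dsimp only [St.set, St.get]
    apply Ex.clear_seq
    dsimp only [St.set, St.get]
    apply Ex.clear_seq
    dsimp only [St.set, St.get]
    apply Ex.clear_seq
    dsimp only [St.set, St.get]
    exact Ex.push _ _ _
  case htu =>
    have h0 := hn 0
    have h1 := hn 1
    have h2 := hn 2
    simp only [St.get, List.length_append, List.length_replicate, List.length_cons,
      List.length_nil, List.length_range]
    omega

/-- The records of the vertices of all positions from `p` on, in case there are `k` of them. The
clauses are used cyclically. -/
def positionRecords (W v : ℕ) (cs : List (Fin 3 → ℕ × Bool)) : ℕ → ℕ → List (List (Bool × Bool))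
  | _, 0 => []
  | p, k + 1 => clauseRecords W (cs.getD (p % cs.length) fun _ => (0, true)) (v + p) ++
      positionRecords W v cs (p + 1) k

theorem records_append (cs ds : List (List (Bool × Bool))) :
    records (cs ++ ds) = records cs ++ records ds := by
  induction cs with
  | nil => rfl
  | cons c cs ih => simp [records, ih]

/-- The register `rr` holds the clauses from that of the position `p` on, or none if it is time to
start again with the first clause. -/
theorem ex_writePosition {W v p : ℕ} {cs : List (Fin 3 → ℕ × Bool)} (hcs : cs ≠ [])
    (hn : ∀ c ∈ cs, ∀ a, (c a).1 < W) (hq : v + p + 1 < W) (s : St) (X : List Bool)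
    (R : List (Fin 3 → ℕ × Bool)) (hR : R = cs.drop (p % cs.length) ∨ R = [] ∧ p % cs.length = 0) :
    ∃ R', (R' = cs.drop ((p + 1) % cs.length) ∨ R' = [] ∧ (p + 1) % cs.length = 0) ∧
    Ex (writePosition : Cmd Reg F)
      { s with rr := clausesCode R, cl := clausesCode cs, u0 := [], u1 := [], u2 := [],
               po := List.replicate (v + p) true ++ [false], wc := List.replicate W true,
               c0 := [], c1 := [], c2 := [], c3 := [], c4 := [], cw := [], tmp := [], xx := X }
      { s with rr := clausesCode R', cl := clausesCode cs, u0 := [], u1 := [], u2 := [],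
               po := List.replicate (v + (p + 1)) true ++ [false], wc := List.replicate W true,
               c0 := [], c1 := [], c2 := [], c3 := [], c4 := [], cw := [], tmp := [],
               xx := (records (clauseRecords W (cs.getD (p % cs.length) fun _ => (0, true))
                 (v + p))).reverse ++ X }
      (290 * W + 5 * (clausesCode cs).length + 175) := by
  have hm : 0 < cs.length := List.length_pos_iff.2 hcs
  set k := p % cs.length with hk
  have hkm : k < cs.length := Nat.mod_lt _ hm
  have hd : cs.drop k = cs[k] :: cs.drop (k + 1) := List.drop_eq_getElem_cons hkm
  have hg : cs.getD k (fun _ => (0, true)) = cs[k] := List.getD_eq_getElem _ _ hkm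
  refine ⟨cs.drop (k + 1), ?_, ?_⟩
  · rcases Nat.lt_or_ge (k + 1) cs.length with h | h
    · left
      rw [Nat.add_mod, ← hk, Nat.add_mod_mod, Nat.mod_eq_of_lt h]
    · right
      have : k + 1 = cs.length := by omega
      refine ⟨List.drop_of_length_le h, ?_⟩
      rw [Nat.add_mod, ← hk, Nat.add_mod_mod, this, Nat.mod_self]
  · rw [hg]
    have h1 : Ex (Cmd.cases .rr (fun o => match o with
        | none => copy 1 .cl .rr .tmp
        | some b => push .rr b) : Cmd Reg F)
        { s with rr := clausesCode R, cl := clausesCode cs, u0 := [], u1 := [], u2 := [],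
                 po := List.replicate (v + p) true ++ [false], wc := List.replicate W true,
                 c0 := [], c1 := [], c2 := [], c3 := [], c4 := [], cw := [], tmp := [], xx := X }
        { s with rr := clauseCode cs[k] ++ clausesCode (cs.drop (k + 1)), cl := clausesCode cs,
                 u0 := [], u1 := [], u2 := [],
                 po := List.replicate (v + p) true ++ [false], wc := List.replicate W true,
                 c0 := [], c1 := [], c2 := [], c3 := [], c4 := [], cw := [], tmp := [], xx := X }
        (5 * (clausesCode cs).length + 3) := by
      have he : clauseCode cs[k] ++ clausesCode (cs.drop (k + 1)) = clausesCode (cs.drop k) := by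
        rw [hd, clausesCode, clausesCode, List.flatMap_cons]
      rw [he]
      rcases hR with rfl | ⟨rfl, h0⟩
      · rw [hd, clausesCode_cons]
        apply Ex.mono
        case h =>
          apply Ex.cases_some
          · rfl
          dsimp only [St.set, St.get]
          exact Ex.push _ _ _
        case htu => omega
      · rw [h0, List.drop_zero]
        apply Ex.mono
        case h =>
          apply Ex.cases_none
          · rfl
          have := Ex.copy_one (F := F) (a := .cl) (b := .rr) (d := .tmp)
            (s := { s with
                 rr := clausesCode [], cl := clausesCode cs, u0 := [], u1 := [], u2 := [],
                 po := List.replicate (v + p) true ++ [false], wc := List.replicate W true,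
                 c0 := [], c1 := [], c2 := [], c3 := [], c4 := [], cw := [], tmp := [], xx := X })
            (by decide) (by decide) (by decide) rfl rfl
          dsimp only [St.set, St.get] at this
          rw [show clausesCode cs ++ clausesCode [] = clausesCode cs from List.append_nil _] at this
          exact this
        case htu => omega
    apply Ex.mono
    case h =>
      apply Ex.seq
      · exact h1
      exact ex_writeClauseRecords (F := F) (W := W) (hn _ (List.getElem_mem hkm)) hq
        { s with cl := clausesCode cs } (clausesCode (cs.drop (k + 1))) X
    case htu => omega

theorem ex_writePositions {W v : ℕ} {cs : List (Fin 3 → ℕ × Bool)} (hcs : cs ≠ [])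
    (hn : ∀ c ∈ cs, ∀ a, (c a).1 < W) (k p : ℕ) (hq : v + p + k < W) (s : St) (X : List Bool)
    (R : List (Fin 3 → ℕ × Bool)) (hR : R = cs.drop (p % cs.length) ∨ R = [] ∧ p % cs.length = 0) :
    ∃ R' : List Bool, R'.length ≤ (clausesCode cs).length ∧
    Ex (writePositions : Cmd Reg F)
      { s with tc := List.replicate k true,
               rr := clausesCode R, cl := clausesCode cs, u0 := [], u1 := [], u2 := [],
               po := List.replicate (v + p) true ++ [false], wc := List.replicate W true,
               c0 := [], c1 := [], c2 := [], c3 := [], c4 := [], cw := [], tmp := [], xx := X }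
      { s with tc := [],
               rr := R', cl := clausesCode cs, u0 := [], u1 := [], u2 := [],
               po := List.replicate (v + (p + k)) true ++ [false], wc := List.replicate W true,
               c0 := [], c1 := [], c2 := [], c3 := [], c4 := [], cw := [], tmp := [],
               xx := (records (positionRecords W v cs p k)).reverse ++ X }
      (k * (290 * W + 5 * (clausesCode cs).length + 176) + 1) := by
  induction k generalizing p R X with
  | zero =>
    refine ⟨clausesCode R, ?_, ?_⟩
    · rcases hR with rfl | ⟨rfl, -⟩
      · conv_rhs => rw [← List.take_append_drop (p % cs.length) cs]
        rw [clausesCode, clausesCode, List.flatMap_append, List.length_append]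
        omega
      · exact Nat.zero_le _
    · exact Ex.loop_nil_le rfl (by omega)
  | succ k ih =>
    obtain ⟨R', hR', h₁⟩ := ex_writePosition (F := F) hcs hn (p := p) (v := v) (by omega)
      { s with tc := List.replicate k true } X R hR
    obtain ⟨R'', hR'', h₂⟩ := ih (p + 1) (by omega)
      ((records (clauseRecords W (cs.getD (p % cs.length) fun _ => (0, true))
        (v + p))).reverse ++ X)
      R' hR'
    refine ⟨R'', hR'', ?_⟩
    have he : p + 1 + k = p + (k + 1) := by omega
    rw [he] at h₂
    simp only [positionRecords, records_append, List.reverse_append, List.append_assoc]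
    apply Ex.loop_cons_le (h₂ := h₂)
    case h => rfl
    case hb => rfl
    case h₁ => exact h₁
    case hv =>
      ring_nf
      omega

end Records

/-! ### Choosing the number of positions -/

section Search

variable {F : Bool → Machine}

namespace Cmd

/-- Increase the number `T` in register `tc` by one, and compare it with the number
`7 * m * (ρ (7 * T) + 1)`, where the subroutine `false` computes `ρ`. -/
def searchStep : Cmd Reg F :=
  push .tc true ;; copy 7 .tc .rin .tmp ;; call false .rin .rout ;; push .rout true ;;
    loop .rout (fun _ => true) (fun _ => copy 7 .mc .kk .tmp) ;;
    loop .tc (fun _ => true) (fun _ => push .tmp true ;; cases .kk fun _ => skip) ;;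
    move .tmp .tc ;; cases .kk (fun o => when o.isSome (push .fl true)) ;; clear .kk

/-- Find the least positive number `T` that is at least `7 * m * (ρ (7 * T) + 1)`. -/
def search : Cmd Reg F := push .fl true ;; loop .fl (fun _ => true) fun _ => searchStep

end Cmd

open Cmd

theorem ex_addTimes (a m b : ℕ) (s : St) :
    Ex (loop .rout (fun _ => true) (fun _ => copy 7 .mc .kk .tmp) : Cmd Reg F)
      { s with rout := List.replicate a true, mc := List.replicate m true, tmp := [],
               kk := List.replicate b true }
      { s with rout := [], mc := List.replicate m true, tmp := [],
               kk := List.replicate (7 * m * a + b) true } (a * (11 * m + 3) + 1) := by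
  induction a generalizing b with
  | zero =>
    rw [Nat.mul_zero, Nat.zero_add]
    exact Ex.loop_nil_le rfl (by omega)
  | succ a ih =>
    have h1 : 7 * m * (a + 1) + b = 7 * m * a + (7 * m + b) := by ring
    have h2 : List.replicate (7 * m + b) true =
      List.replicate (7 * m) true ++ List.replicate b true := List.replicate_add ..
    have ih := ih (7 * m + b)
    rw [h2] at ih
    rw [h1]
    apply Ex.loop_cons_le (h₂ := ih)
    case h => rfl
    case hb => rfl
    case h₁ => exact Ex.copy_unary (by decide) (by decide) (by decide) rfl rfl
    case hv =>
      ring_nf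
      omega

theorem ex_subtract (a b c : ℕ) (s : St) :
    Ex (loop .tc (fun _ => true) (fun _ => push .tmp true ;; cases .kk fun _ => skip) : Cmd Reg F)
      { s with tc := List.replicate a true, tmp := List.replicate c true,
               kk := List.replicate b true }
      { s with tc := [], tmp := List.replicate (a + c) true,
               kk := List.replicate (b - a) true } (3 * a + 1) := by
  induction a generalizing b c with
  | zero =>
    rw [Nat.zero_add]
    exact Ex.loop_nil_le rfl (by omega)
  | succ a ih =>
    have h1 : a + 1 + c = a + (c + 1) := by ring
    have h2 : b - (a + 1) = b - 1 - a := by omega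
    rw [h1, h2]
    apply Ex.loop_cons_le (h₂ := ih (b - 1) (c + 1))
    case h => rfl
    case hb => rfl
    case h₁ =>
      apply Ex.push_seq
      dsimp only [St.set, St.get]
      apply Ex.cases_head
      dsimp only [St.set, St.get]
      rw [List.tail_replicate]
      exact Ex.skip _
    case hv => omega

theorem ex_searchStep {T m ρ q : ℕ} (h : (F false).OutputsWithin
      (List.replicate (7 * (T + 1)) true) (List.replicate ρ true) q) (s : St) :
    Ex (searchStep : Cmd Reg F)
      { s with mc := List.replicate m true, tc := List.replicate T true, rin := [], rout := [],
               kk := [], fl := [], tmp := [] }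
      { s with mc := List.replicate m true, tc := List.replicate (T + 1) true, rin := [],
               rout := [], kk := [], fl := if T + 1 < 7 * m * (ρ + 1) then [true] else [],
               tmp := [] }
      (q + 25 * (T + 1) + (ρ + 1) * (18 * m + 4) + 20) := by
  apply Ex.mono
  case h =>
    apply Ex.push_seq
    dsimp only [St.set, St.get]
    apply Ex.seq
    · exact Ex.copy_unary (n := T + 1) (by decide) (by decide) (by decide) rfl rfl
    dsimp only [St.set, St.get]
    rw [List.append_nil]
    apply Ex.seq
    · exact Ex.call (by decide) (l := List.replicate (7 * (T + 1)) true)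
        (by rw [List.reverse_replicate]; rfl) h
    dsimp only [St.set, St.get]
    rw [List.append_nil, List.reverse_replicate]
    apply Ex.push_seq
    dsimp only [St.set, St.get]
    apply Ex.seq
    · exact ex_addTimes (F := F) (ρ + 1) m 0
        { s with tc := List.replicate (T + 1) true, rin := [], fl := [] }
    dsimp only [St.set, St.get]
    apply Ex.seq
    · exact ex_subtract (F := F) (T + 1) (7 * m * (ρ + 1) + 0) 0
        { s with mc := List.replicate m true, rin := [], rout := [], fl := [] }
    dsimp only [St.set, St.get]
    apply Ex.move_seq (by decide)
    dsimp only [St.set, St.get]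
    rw [List.append_nil, List.reverse_replicate]
    apply Ex.seq
    · apply Ex.cases_head
      exact Ex.when_push _ _ _ _
    dsimp only [St.set, St.get]
    have : ((List.replicate (7 * m * (ρ + 1) + 0 - (T + 1)) true).head?.isSome = true) ↔
        T + 1 < 7 * m * (ρ + 1) := by
      rw [List.isSome_head?, List.ne_nil_iff_length_pos, List.length_replicate]
      omega
    simp only [this]
    exact Ex.clear rfl
  case htu =>
    simp only [List.length_replicate, St.get, List.length_tail]
    ring_nf
    omega

/-- The search, if `j + 1` more steps are to be made until the number `T` is found. -/
theorem ex_search_from {T m Q R : ℕ} {ρ q : ℕ → ℕ}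
    (hF : ∀ n, (F false).OutputsWithin (List.replicate n true) (List.replicate (ρ n) true) (q n))
    (hT : 7 * m * (ρ (7 * T) + 1) ≤ T)
    (hmin : ∀ k, 0 < k → k < T → k < 7 * m * (ρ (7 * k) + 1))
    (hQ : ∀ k ≤ T, q (7 * k) ≤ Q) (hR : ∀ k ≤ T, ρ (7 * k) ≤ R) (s : St) (j : ℕ) (hj : j < T) :
    Ex (loop .fl (fun _ => true) fun _ => searchStep : Cmd Reg F)
      { s with mc := List.replicate m true, tc := List.replicate (T - (j + 1)) true, rin := [],
               rout := [], kk := [], fl := [true], tmp := [] }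
      { s with mc := List.replicate m true, tc := List.replicate T true, rin := [],
               rout := [], kk := [], fl := [], tmp := [] }
      ((j + 1) * (Q + 25 * T + (R + 1) * (18 * m + 4) + 21) + 1) := by
  have step (j : ℕ) (hj : j < T) : ∃ t, t + 1 ≤ Q + 25 * T + (R + 1) * (18 * m + 4) + 21 ∧
      Ex (searchStep : Cmd Reg F)
        { s with mc := List.replicate m true, tc := List.replicate (T - (j + 1)) true, rin := [],
                 rout := [], kk := [], fl := [], tmp := [] }
        { s with mc := List.replicate m true, tc := List.replicate (T - j) true, rin := [],
                 rout := [], kk := [],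
                 fl := if T - j < 7 * m * (ρ (7 * (T - j)) + 1) then [true] else [],
                 tmp := [] } t := by
    have h := ex_searchStep (F := F) (T := T - (j + 1)) (m := m) (hF _) s
    have e1 : T - (j + 1) + 1 = T - j := by omega
    rw [e1] at h
    refine ⟨_, ?_, h⟩
    have h1 := hQ (T - j) (by omega)
    have h2 := Nat.mul_le_mul_right (18 * m + 4) (Nat.add_le_add_right (hR (T - j) (by omega)) 1)
    omega
  induction j with
  | zero =>
    obtain ⟨t, ht, h⟩ := step 0 hj
    rw [Nat.sub_zero, if_neg (by omega)] at h
    apply Ex.loop_cons_le (h₂ := Ex.loop_nil rfl)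
    case h => rfl
    case hb => rfl
    case h₁ => exact h
    case hv => omega
  | succ j ih =>
    obtain ⟨t, ht, h⟩ := step (j + 1) hj
    rw [if_pos (hmin _ (by omega) (by omega))] at h
    apply Ex.loop_cons_le (h₂ := ih (by omega))
    case h => rfl
    case hb => rfl
    case h₁ => exact h
    case hv =>
      rw [Nat.succ_mul (j + 1)]
      omega

theorem ex_search {T m Q R : ℕ} {ρ q : ℕ → ℕ} (hm : 0 < m)
    (hF : ∀ n, (F false).OutputsWithin (List.replicate n true) (List.replicate (ρ n) true) (q n))
    (hT : 7 * m * (ρ (7 * T) + 1) ≤ T)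
    (hmin : ∀ k, 0 < k → k < T → k < 7 * m * (ρ (7 * k) + 1))
    (hQ : ∀ k ≤ T, q (7 * k) ≤ Q) (hR : ∀ k ≤ T, ρ (7 * k) ≤ R) (s : St) :
    Ex (search : Cmd Reg F)
      { s with mc := List.replicate m true, tc := [], rin := [], rout := [],
               kk := [], fl := [], tmp := [] }
      { s with mc := List.replicate m true, tc := List.replicate T true, rin := [],
               rout := [], kk := [], fl := [], tmp := [] }
      (T * (Q + 25 * T + (R + 1) * (18 * m + 4) + 21) + 2) := by
  have hT0 : 0 < T := lt_of_lt_of_le (by positivity) hT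
  obtain ⟨j, rfl⟩ : ∃ j, T = j + 1 := ⟨T - 1, by omega⟩
  have h := ex_search_from hF hT hmin hQ hR s j (by omega)
  rw [Nat.sub_self] at h
  apply Ex.mono
  case h =>
    apply Ex.push_seq
    exact h
  case htu => omega

end Search

/-! ### Reading off the answer -/

section Answer

variable {F : Bool → Machine}

namespace Cmd

/-- Whether the word in register `zz` contains `true` more than `7 * m` times. -/
def answer : Cmd Reg F :=
  copy 7 .mc .kk .tmp ;;
    loop .zz (fun _ => true) (fun b => when b (cases .kk fun o =>
      when o.isNone (push .fl true))) ;;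
    clear .kk ;; cases .fl (fun o => push .out (o.getD false)) ;; clear .fl

end Cmd

open Cmd

/-- The counter `kk` is used up before the flag `fl` is touched, so that at any time one of them is
empty. -/
theorem ex_count (l : List Bool) (k f : ℕ) (hkf : k = 0 ∨ f = 0) (s : St) :
    Ex (loop .zz (fun _ => true) (fun b => when b (cases .kk fun o =>
      when o.isNone (push .fl true))) : Cmd Reg F)
      { s with zz := l, kk := List.replicate k true, fl := List.replicate f true }
      { s with zz := [], kk := List.replicate (k - l.count true) true,
               fl := List.replicate (f + l.count true - k) true } (3 * l.length + 1) := by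
  induction l generalizing k f with
  | nil =>
    have : f + List.count true [] - k = f := by
      rw [List.count_nil]; omega
    rw [this]
    exact Ex.loop_nil rfl
  | cons b l ih =>
    cases b with
    | false =>
      rw [List.count_cons_of_ne (by decide)]
      apply Ex.loop_cons_le (h₂ := ih k f hkf)
      case h => rfl
      case hb => rfl
      case h₁ => exact Ex.skip _
      case hv => simp only [List.length_cons]; omega
    | true =>
      rw [List.count_cons_self]
      rcases k with _ | k
      · have h1 : f + (l.count true + 1) - 0 = f + 1 + l.count true - 0 := by omega
        have h2 : 0 - (l.count true + 1) = 0 - l.count true := by omega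
        rw [h1, h2]
        apply Ex.loop_cons_le (h₂ := ih 0 (f + 1) (Or.inl rfl))
        case h => rfl
        case hb => rfl
        case h₁ =>
          apply Ex.cases_none
          · rfl
          exact Ex.push _ _ _
        case hv => simp only [List.length_cons]; omega
      · have hf : f = 0 := by omega
        subst hf
        have h1 : 0 + (l.count true + 1) - (k + 1) = 0 + l.count true - k := by omega
        have h2 : k + 1 - (l.count true + 1) = k - l.count true := by omega
        rw [h1, h2]
        apply Ex.loop_cons_le (h₂ := ih k 0 (Or.inr rfl))
        case h => rfl
        case hb => rfl
        case h₁ =>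
          apply Ex.cases_some
          · rfl
          exact Ex.skip _
        case hv => simp only [List.length_cons]; omega

theorem ex_answer (l : List Bool) (m : ℕ) (s : St) :
    Ex (answer : Cmd Reg F)
      { s with zz := l, mc := List.replicate m true, kk := [], fl := [], tmp := [], out := [] }
      { s with zz := [], mc := List.replicate m true, kk := [], fl := [], tmp := [],
               out := [decide (7 * m < l.count true)] } (20 * m + 6 * l.length + 10) := by
  apply Ex.mono
  case h =>
    apply Ex.seq
    · exact Ex.copy_unary (n := m) (by decide) (by decide) (by decide) rfl rfl
    dsimp only [St.set, St.get]
    rw [List.append_nil]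
    apply Ex.seq
    · exact ex_count (F := F) l (7 * m) 0 (Or.inr rfl)
        { s with mc := List.replicate m true, tmp := [], out := [] }
    dsimp only [St.set, St.get]
    apply Ex.clear_seq
    dsimp only [St.set, St.get]
    apply Ex.seq
    · apply Ex.cases_head
      exact Ex.push _ _ _
    dsimp only [St.set, St.get]
    have : (List.replicate (0 + l.count true - 7 * m) true).head?.getD false =
        decide (7 * m < l.count true) := by
      rcases h : 0 + l.count true - 7 * m with _ | k
      · rw [decide_eq_false (by omega)]; rfl
      · rw [decide_eq_true (by omega)]; rfl
    rw [this]
    exact Ex.clear rfl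
  case htu =>
    have := List.count_le_length (a := true) (l := l)
    simp only [List.length_replicate, St.get, List.length_tail]
    omega

end Answer

/-! ### The program that decides 3-SAT -/

section Program

variable {F : Bool → Machine}

namespace Cmd

/-- Decide whether a formula with at least one clause is satisfiable. -/
def decideClauses : Cmd Reg F :=
  search ;; push .po false ;; copy 1 .vc .po .tmp ;; copy 1 .vc .wc .tmp ;; copy 1 .tc .wc .tmp ;;
    push .wc true ;; writePositions ;; move .xx .x1 ;; copy 1 .x1 .x2 .tmp ;; push .dg false ;;
    writeRows ;; call true .yy .zz ;; answer ;;
    clear .vc ;; clear .mc ;; clear .cl ;; clear .rr ;; clear .po ;; clear .wc ;; clear .x2 ;;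
    clear .dg

/-- Decide whether a formula is satisfiable. -/
def decideFormula : Cmd Reg F :=
  moveUnary .inp .vc ;; readClauses ;; move .tmp .cl ;; cases .mc fun o => match o with
    | none => clear .vc ;; push .out true
    | some _ => push .mc true ;; decideClauses

end Cmd

open Cmd

theorem length_positionRecords (W v : ℕ) (cs : List (Fin 3 → ℕ × Bool)) (p k : ℕ) :
    (positionRecords W v cs p k).length = 7 * k := by
  induction k generalizing p with
  | zero => rfl
  | succ k ih =>
    rw [positionRecords, List.length_append, ih, clauseRecords, List.length_map, List.length_range]
    ring

theorem length_of_mem_positionRecords {W v : ℕ} {cs : List (Fin 3 → ℕ × Bool)} {p k : ℕ}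
    {d : List (Bool × Bool)} (hd : d ∈ positionRecords W v cs p k) : d.length = W := by
  induction k generalizing p with
  | zero => simp [positionRecords] at hd
  | succ k ih =>
    rw [positionRecords, List.mem_append] at hd
    rcases hd with hd | hd
    · obtain ⟨e, -, rfl⟩ := List.mem_map.1 hd
      exact length_vertexRecord _ _ _ _
    · exact ih hd

theorem length_rowBits (c : List (Bool × Bool)) (D : List Bool) (ds : List (List (Bool × Bool))) :
    (rowBits c D ds).length = ds.length := by
  induction ds generalizing D with
  | nil => rfl
  | cons d ds ih => simp [rowBits, ih]

theorem length_matrixBits (i : ℕ) (cs ds : List (List (Bool × Bool))) :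
    (matrixBits i cs ds).length = cs.length * ds.length := by
  induction cs generalizing i with
  | nil => simp [matrixBits]
  | cons c cs ih => simp [matrixBits, ih, length_rowBits]; ring

theorem length_le_length_clausesCode (cs : List (Fin 3 → ℕ × Bool)) :
    cs.length ≤ (clausesCode cs).length := by
  induction cs with
  | nil => exact Nat.zero_le _
  | cons c cs ih =>
    rw [length_clausesCode_cons, List.length_cons]
    omega

/-- A run of the program, with one call of the approximation algorithm, which takes `tM` steps, and
otherwise a number of steps that is polynomial in a bound `A` for all numbers involved. -/
theorem ex_decideClauses {v T A tM : ℕ} {ρ q : ℕ → ℕ} {cs : List (Fin 3 → ℕ × Bool)}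
    {l : List Bool} (hcs : cs ≠ []) (hv : ∀ c ∈ cs, ∀ a, (c a).1 < v)
    (hF : ∀ n, (F false).OutputsWithin (List.replicate n true) (List.replicate (ρ n) true) (q n))
    (hT : 7 * cs.length * (ρ (7 * T) + 1) ≤ T)
    (hmin : ∀ k, 0 < k → k < T → k < 7 * cs.length * (ρ (7 * k) + 1))
    (hM : (F true).OutputsWithin
      (matrixBits 0 (positionRecords (v + T + 1) v cs 0 T) (positionRecords (v + T + 1) v cs 0 T))
      l tM) (hl : l.length = 7 * T)
    (hvA : v ≤ A) (hTA : T ≤ A) (hcA : (clausesCode cs).length ≤ A)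
    (hqA : ∀ k ≤ T, q (7 * k) ≤ A) (hρA : ∀ k ≤ T, ρ (7 * k) ≤ A) :
    Ex (decideClauses : Cmd Reg F)
      { St.empty with vc := List.replicate v true, mc := List.replicate cs.length true,
                      cl := clausesCode cs }
      { St.empty with out := [decide (7 * cs.length < l.count true)] } (tM + 20000 * A ^ 3) := by
  set W := v + T + 1 with hW
  set recs := positionRecords W v cs 0 T with hrecs
  set m := cs.length with hmdef
  have hm : 0 < m := List.length_pos_iff.2 hcs
  have hmA : m ≤ A := (length_le_length_clausesCode cs).trans hcA
  have hA : 0 < A := hm.trans_le hmA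
  have hWA : W ≤ 3 * A := by omega
  have hN : recs.length = 7 * T := length_positionRecords _ _ _ _ _
  have hrW : ∀ d ∈ recs, d.length = W := fun d hd => length_of_mem_positionRecords hd
  have hA2 : A ≤ A ^ 2 := Nat.le_self_pow (by norm_num) A
  have hA3 : A ^ 2 ≤ A ^ 3 := Nat.pow_le_pow_right hA (by norm_num)
  have hX : (records recs).length ≤ 77 * A ^ 2 := by
    rw [length_records hrW, hN]
    calc 7 * T * (3 * W + 2) ≤ 7 * A * (3 * (3 * A) + 2 * A) := by gcongr; omega
      _ = 77 * A ^ 2 := by ring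
  have hNN : (matrixBits 0 recs recs).length ≤ 49 * A ^ 2 := by
    rw [length_matrixBits, hN]
    calc 7 * T * (7 * T) ≤ 7 * A * (7 * A) := by gcongr
      _ = 49 * A ^ 2 := by ring
  have h1 : Ex (search : Cmd Reg F)
      { St.empty with vc := List.replicate v true, mc := List.replicate m true,
                      cl := clausesCode cs }
      { St.empty with vc := List.replicate v true, mc := List.replicate m true,
                      cl := clausesCode cs, tc := List.replicate T true } (93 * A ^ 3) := by
    refine (ex_search (F := F) hm hF hT hmin hqA hρA
      { St.empty with vc := List.replicate v true, cl := clausesCode cs }).mono ?_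
    calc T * (A + 25 * T + (A + 1) * (18 * m + 4) + 21) + 2 ≤
        A * (A + 25 * A + (A + A) * (18 * A + 4 * A) + 21 * A) + 2 * A := by gcongr <;> omega
      _ = 44 * A ^ 3 + 47 * A ^ 2 + 2 * A := by ring
      _ ≤ 93 * A ^ 3 := by omega
  obtain ⟨R, hR, h2⟩ := ex_writePositions (F := F) (W := W) (v := v) hcs
    (fun c hc a => (hv c hc a).trans_le (by omega)) T 0 (by omega)
    { St.empty with vc := List.replicate v true, mc := List.replicate m true } []
    [] (Or.inr ⟨rfl, Nat.zero_mod _⟩)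
  rw [List.append_nil, Nat.zero_add, ← hrecs] at h2
  replace h2 := h2.mono (u := 1052 * A ^ 3) (by
    calc T * (290 * W + 5 * (clausesCode cs).length + 176) + 1 ≤
        A * (290 * (3 * A) + 5 * A + 176 * A) + A := by gcongr <;> omega
      _ = 1051 * A ^ 2 + A := by ring
      _ ≤ 1052 * A ^ 3 := by omega)
  have h3 := ex_writeRows (F := F) recs hN hrW recs hrW 0 (by omega)
    { St.empty with vc := List.replicate v true, mc := List.replicate m true, rr := R,
                    cl := clausesCode cs, po := List.replicate (v + T) true ++ [false],
                    wc := List.replicate W true } []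
  rw [List.append_nil] at h3
  replace h3 := h3.mono (u := 8961 * A ^ 3) (by
    rw [hN]
    calc 7 * T * ((7 * T + 1) * (40 * W + 40)) + 1 ≤
        7 * A * ((7 * A + A) * (40 * (3 * A) + 40 * A)) + A := by gcongr <;> omega
      _ = 8960 * A ^ 3 + A := by ring
      _ ≤ 8961 * A ^ 3 := by omega)
  have hwc : List.replicate W true =
      true :: (List.replicate T true ++ List.replicate v true) := by
    rw [hW, List.replicate_succ, Nat.add_comm v, List.replicate_add]
  apply Ex.mono
  case h =>
    apply Ex.seq
    · exact h1
    apply Ex.push_seq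
    dsimp only [St.set, St.get, St.empty]
    apply Ex.seq
    · exact Ex.copy_one (by decide) (by decide) (by decide) rfl rfl
    dsimp only [St.set, St.get]
    apply Ex.seq
    · exact Ex.copy_one (by decide) (by decide) (by decide) rfl rfl
    dsimp only [St.set, St.get]
    apply Ex.seq
    · exact Ex.copy_one (by decide) (by decide) (by decide) rfl rfl
    dsimp only [St.set, St.get]
    apply Ex.push_seq
    dsimp only [St.set, St.get]
    rw [List.append_nil, ← hwc]
    apply Ex.seq
    · exact h2
    apply Ex.move_seq (by decide)
    dsimp only [St.set, St.get, St.empty]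
    rw [List.append_nil, List.reverse_reverse]
    apply Ex.seq
    · exact Ex.copy_one (by decide) (by decide) (by decide) rfl rfl
    dsimp only [St.set, St.get]
    rw [List.append_nil]
    apply Ex.push_seq
    dsimp only [St.set, St.get]
    apply Ex.seq
    · exact h3
    apply Ex.seq
    · exact Ex.call (by decide) rfl hM
    dsimp only [St.set, St.get, St.empty]
    rw [List.append_nil]
    apply Ex.seq
    · exact ex_answer (F := F) l.reverse m
        { St.empty with vc := List.replicate v true, rr := R,
                        cl := clausesCode cs, po := List.replicate (v + T) true ++ [false],
                        wc := List.replicate W true, x2 := records recs,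
                        dg := List.replicate (0 + recs.length) true ++ [false] }
    dsimp only [St.set, St.get, St.empty]
    rw [List.count_reverse]
    apply Ex.clear_seq
    dsimp only [St.set, St.get]
    apply Ex.clear_seq
    dsimp only [St.set, St.get]
    apply Ex.clear_seq
    dsimp only [St.set, St.get]
    apply Ex.clear_seq
    dsimp only [St.set, St.get]
    apply Ex.clear_seq
    dsimp only [St.set, St.get]
    apply Ex.clear_seq
    dsimp only [St.set, St.get]
    apply Ex.clear_seq
    dsimp only [St.set, St.get]
    exact Ex.clear rfl
  case htu =>
    simp only [List.length_replicate, St.get, List.length_reverse, List.length_append,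
      List.length_cons, List.length_nil, hN, hl]
    clear h1 h2 h3 hF hM hT hmin hqA hρA hrW hv hwc
    clear_value W recs m
    linarith

theorem ex_decideFormula {v t : ℕ} {cs : List (Fin 3 → ℕ × Bool)} {b : Bool} (hcs : cs ≠ [])
    (h : Ex (decideClauses : Cmd Reg F)
      { St.empty with vc := List.replicate v true, mc := List.replicate cs.length true,
                      cl := clausesCode cs }
      { St.empty with out := [b] } t) :
    Ex (decideFormula : Cmd Reg F)
      { St.empty with inp := List.replicate v true ++ false :: clausesCode cs }
      { St.empty with out := [b] } (t + 2 * v + 5 * (clausesCode cs).length + 10) := by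
  obtain ⟨m, hm⟩ : ∃ m, cs.length = m + 1 :=
    ⟨cs.length - 1, by have := List.length_pos_iff.2 hcs; omega⟩
  apply Ex.mono
  case h =>
    apply Ex.seq
    · exact Ex.moveUnary (by decide) rfl
    dsimp only [St.set, St.get, St.empty]
    rw [List.append_nil]
    apply Ex.seq
    · exact ex_readClauses (F := F) cs { St.empty with vc := List.replicate v true } [] []
    dsimp only [St.set, St.get, St.empty]
    rw [List.append_nil, List.append_nil]
    apply Ex.move_seq (by decide)
    dsimp only [St.set, St.get]
    rw [List.append_nil, List.reverse_reverse, hm]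
    apply Ex.cases_some
    · rfl
    dsimp only [St.set, St.get]
    apply Ex.push_seq
    dsimp only [St.set, St.get]
    rw [hm] at h
    exact h
  case htu =>
    simp only [St.get, List.length_reverse]
    omega

theorem ex_decideFormula_nil (v : ℕ) :
    Ex (decideFormula : Cmd Reg F) { St.empty with inp := List.replicate v true ++ [false] }
      { St.empty with out := [true] } (3 * v + 10) := by
  apply Ex.mono
  case h =>
    apply Ex.seq
    · exact Ex.moveUnary (by decide) rfl
    dsimp only [St.set, St.get, St.empty]
    rw [List.append_nil]
    apply Ex.seq
    · exact ex_readClauses (F := F) [] { St.empty with vc := List.replicate v true } [] []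
    dsimp only [St.set, St.get, St.empty]
    apply Ex.move_seq (by decide)
    dsimp only [St.set, St.get]
    apply Ex.cases_none
    · rfl
    dsimp only [St.set, St.get]
    apply Ex.clear_seq
    dsimp only [St.set, St.get]
    exact Ex.push _ _ _
  case htu =>
    simp only [St.get, List.length_replicate, clausesCode, List.flatMap_nil, List.length_nil,
      List.reverse_nil, List.append_nil]
    omega

theorem Ex.outputsWithin {P : Cmd Reg F} {l l' : List Bool} {t : ℕ}
    (h : Ex P { St.empty with inp := l } { St.empty with out := l' } t) :
    (P.toMachine .inp .out).OutputsWithin l l' (t + 1) := by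
  apply Runs.outputsWithin
  have h0 : St.empty.get = fun _ => [] := by funext k; cases k <;> rfl
  rw [← h0, ← St.get_set, ← St.get_set]
  exact h

end Program

/-! ### The graph of a formula -/

section Graph

/-- The vertex `i` belongs to the position `i / 7`, whose clause is `L (i / 7)`, and to a nonempty
set of literals of this clause. It carries the tokens `(x, b)` for the variables `x` of the clause,
where `b` is the value of `x` that makes precisely these literals true (one token for each literal),
and two tokens that link the position to the next one and to the previous one. -/
def Tok (L : ℕ → Fin 3 → ℕ × Bool) (v i k : ℕ) (b : Bool) : Prop :=
  (∃ a, (L (i / 7) a).1 = k ∧ maskValue (i % 7) (L (i / 7) a).2 a = b) ∨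
    (b = true ∧ k = v + i / 7) ∨ (b = false ∧ k = v + i / 7 + 1)

/-- Two vertices clash if they carry opposite tokens. -/
def Clash (L : ℕ → Fin 3 → ℕ × Bool) (v i j : ℕ) : Prop :=
  ∃ k b, Tok L v i k b ∧ Tok L v j k (!b)

theorem Clash.symm {L : ℕ → Fin 3 → ℕ × Bool} {v i j : ℕ} (h : Clash L v i j) :
    Clash L v j i := by
  obtain ⟨k, b, h₁, h₂⟩ := h
  exact ⟨k, !b, h₂, by rwa [Bool.not_not]⟩

/-- The graph of the formula with clauses `L`, with `T` positions: vertices are adjacent if they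
clash. -/
def clashGraph (L : ℕ → Fin 3 → ℕ × Bool) (v T : ℕ) : SimpleGraph (Fin (7 * T)) where
  Adj i j := i ≠ j ∧ Clash L v i j
  symm := ⟨fun _ _ h => ⟨h.1.symm, h.2.symm⟩⟩
  loopless := ⟨fun _ h => h.1 rfl⟩

variable {L : ℕ → Fin 3 → ℕ × Bool} {v : ℕ}

theorem exists_testBit_eq (g : Fin 3 → Bool) (hg : ∃ a, g a = true) :
    ∃ e < 7, ∀ a : Fin 3, (e + 1).testBit a = g a := by
  revert g
  decide

theorem eq_of_testBit {e e' : ℕ} (he : e < 7) (he' : e' < 7)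
    (h : ∀ a : Fin 3, (e + 1).testBit a = (e' + 1).testBit a) : e = e' := by
  revert h
  interval_cases e <;> interval_cases e' <;> decide

theorem exists_testBit {e : ℕ} (he : e < 7) : ∃ a : Fin 3, (e + 1).testBit a = true := by
  interval_cases e <;> decide

/-- A finite sequence of vertices that is an induced path, as a vertex set. -/
theorem inducesPath_map {V : Type*} {G : SimpleGraph V} {n : ℕ} (q : Fin n ↪ V)
    (h : ∀ a b, G.Adj (q a) (q b) ↔ (a : ℕ) + 1 = b ∨ (b : ℕ) + 1 = a) :
    InducesPath G (Finset.univ.map q) := by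
  have e : (Finset.univ.map q : Finset V).card = n := by simp
  unfold InducesPath
  rw [e]
  refine ⟨(RelIso.mk ((Equiv.ofInjective q q.injective).trans (Equiv.setCongr (by simp))) ?_ :
    SimpleGraph.pathGraph n ≃g _).symm⟩
  intro a b
  rw [SimpleGraph.pathGraph_adj]
  exact h a b

theorem InducesPath.exists_enumeration {V : Type*} {G : SimpleGraph V} {S : Finset V}
    (h : InducesPath G S) : ∃ q : Fin S.card → V, Injective q ∧
      ∀ a b, G.Adj (q a) (q b) ↔ (a : ℕ) + 1 = b ∨ (b : ℕ) + 1 = a := by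
  obtain ⟨e⟩ := h
  refine ⟨fun a => (e.symm a).1, fun a b hab => e.symm.injective (Subtype.ext hab), fun a b => ?_⟩
  rw [← SimpleGraph.pathGraph_adj]
  exact e.symm.map_rel_iff (a := a) (b := b)

/-- A satisfying assignment yields an induced path with one vertex for each position. -/
theorem exists_inducesPath_of_satisfying (hv : ∀ p a, (L p a).1 < v) (T : ℕ) (τ : ℕ → Bool)
    (hτ : ∀ p, ∃ a, τ (L p a).1 = (L p a).2) :
    ∃ S : Finset (Fin (7 * T)), S.card = T ∧ InducesPath (clashGraph L v T) S := by
  have : ∀ p, ∃ e < 7, ∀ a : Fin 3, (e + 1).testBit a = (τ (L p a).1 == (L p a).2) := fun p =>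
    exists_testBit_eq _ (by simpa using hτ p)
  choose e he hea using this
  have hd (p : ℕ) : (7 * p + e p) / 7 = p := by have := he p; omega
  have hmod (p : ℕ) : (7 * p + e p) % 7 = e p := by have := he p; omega
  have htok (p k : ℕ) (b : Bool) : Tok L v (7 * p + e p) k b ↔
      (∃ a, (L p a).1 = k ∧ τ k = b) ∨ (b = true ∧ k = v + p) ∨ (b = false ∧ k = v + p + 1) := by
    rw [Tok, hd, hmod]
    refine or_congr_left (exists_congr fun a => and_congr_right ?_)
    rintro rfl
    rw [maskValue, hea]
    cases τ (L p a).1 <;> cases (L p a).2 <;> simp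
  have hclash (p p' : ℕ) : Clash L v (7 * p + e p) (7 * p' + e p') ↔ p + 1 = p' ∨ p' + 1 = p := by
    constructor
    · rintro ⟨k, b, h₁, h₂⟩
      rw [htok] at h₁ h₂
      rcases h₁ with ⟨a, rfl, h₁⟩ | ⟨rfl, h₁⟩ | ⟨rfl, h₁⟩ <;>
        rcases h₂ with ⟨a', h₃, h₂⟩ | ⟨h₃, h₂⟩ | ⟨h₃, h₂⟩
      · rw [h₁] at h₂; cases b <;> simp at h₂
      · have := hv p a; omega
      · have := hv p a; omega
      · have := hv p' a'; omega
      · simp at h₃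
      · omega
      · have := hv p' a'; omega
      · omega
      · simp at h₃
    · rintro (rfl | rfl)
      · exact ⟨v + p + 1, false, by simp [htok], by simp [htok]; omega⟩
      · exact ⟨v + p' + 1, true, by simp [htok]; omega, by simp [htok]⟩
  refine ⟨Finset.univ.map (⟨fun p : Fin T => (⟨7 * p + e p, by
    have := he p; have := p.2; omega⟩ : Fin (7 * T)), fun p p' h => ?_⟩ : Fin T ↪ _), by simp,
    inducesPath_map _ fun p p' => ?_⟩
  · have h' : 7 * (p : ℕ) + e p = 7 * p' + e p' := congrArg Fin.val h
    have := he p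
    have := he p'
    exact Fin.ext (by omega)
  · constructor
    · rintro ⟨-, h⟩
      exact (hclash p p').1 h
    · intro h
      refine ⟨fun h' => ?_, (hclash p p').2 h⟩
      have h' : 7 * (p : ℕ) + e p = 7 * p' + e p' := congrArg Fin.val h'
      have := he p
      have := he p'
      omega

end Graph

/-! ### Induced paths in the graph of an unsatisfiable formula -/

section LongPath

variable {L : ℕ → Fin 3 → ℕ × Bool} {v : ℕ}

/-- An enumeration `P 0, …, P (n - 1)` of an induced path. -/
structure PathEnum (L : ℕ → Fin 3 → ℕ × Bool) (v n : ℕ) (P : ℕ → ℕ) : Prop where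
  inj : ∀ a < n, ∀ b < n, P a = P b → a = b
  clash : ∀ a < n, ∀ b < n, a ≠ b → (Clash L v (P a) (P b) ↔ a + 1 = b ∨ b + 1 = a)

/-- A variable is mixed if both of its values occur on the path. -/
def MixedVar (L : ℕ → Fin 3 → ℕ × Bool) (v n : ℕ) (P : ℕ → ℕ) (x : ℕ) : Prop :=
  (∃ a < n, Tok L v (P a) x true) ∧ ∃ a < n, Tok L v (P a) x false

/-- A position is mixed if its clause contains a mixed variable. -/
def MixedPos (L : ℕ → Fin 3 → ℕ × Bool) (v n : ℕ) (P : ℕ → ℕ) (p : ℕ) : Prop :=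
  ∃ s, MixedVar L v n P (L p s).1

theorem MixedPos.congr {n p p' : ℕ} {P : ℕ → ℕ} (h : MixedPos L v n P p) (hp : L p = L p') :
    MixedPos L v n P p' := by
  unfold MixedPos at *
  rwa [← hp]

theorem tok_var (i : ℕ) (s : Fin 3) :
    Tok L v i (L (i / 7) s).1 (maskValue (i % 7) (L (i / 7) s).2 s) :=
  Or.inl ⟨s, rfl, rfl⟩

namespace PathEnum

variable {n : ℕ} {P : ℕ → ℕ}

/-- The vertices that carry a mixed variable are close together, since a path contains no large
complete bipartite graph. -/
theorem le_add_two (h : PathEnum L v n P) {x a b : ℕ} {c d : Bool} (hx : MixedVar L v n P x)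
    (ha : a < n) (hb : b < n) (hac : Tok L v (P a) x c) (hbd : Tok L v (P b) x d) :
    a ≤ b + 2 := by
  obtain ⟨⟨i, hi, hit⟩, ⟨j, hj, hjf⟩⟩ := hx
  have key {a b : ℕ} (ha : a < n) (hb : b < n) (h₁ : Tok L v (P a) x true)
      (h₂ : Tok L v (P b) x false) : a ≤ b + 1 ∧ b ≤ a + 1 := by
    by_cases hab : a = b
    · omega
    · have := (h.clash a ha b hb hab).1 ⟨x, true, h₁, h₂⟩
      omega
  cases c <;> cases d
  · have := key hi ha hit hac
    have := key hi hb hit hbd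
    omega
  · have := key hb ha hbd hac
    omega
  · have := key ha hb hac hbd
    omega
  · have := key ha hj hac hjf
    have := key hb hj hbd hjf
    omega

theorem le_add_two_of_mixedPos (h : PathEnum L v n P) {a b : ℕ} (ha : a < n) (hb : b < n)
    (hab : L (P a / 7) = L (P b / 7)) (hm : MixedPos L v n P (P a / 7)) : a ≤ b + 2 := by
  obtain ⟨s, hs⟩ := hm
  have h₂ := tok_var (L := L) (v := v) (P b) s
  rw [← hab] at h₂
  exact h.le_add_two hs ha hb (tok_var _ s) h₂

/-- Unmixed positions are visited only once. -/
theorem eq_of_pos_eq (h : PathEnum L v n P) {a b : ℕ} (ha : a < n) (hb : b < n)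
    (hm : ¬ MixedPos L v n P (P a / 7)) (hab : P a / 7 = P b / 7) : a = b := by
  by_contra hne
  have hP : P a ≠ P b := fun hP => hne (h.inj a ha b hb hP)
  have hmod : P a % 7 ≠ P b % 7 := by omega
  have : ∃ s : Fin 3, (P a % 7 + 1).testBit s ≠ (P b % 7 + 1).testBit s := by
    by_contra! hs
    exact hmod (eq_of_testBit (Nat.mod_lt _ (by norm_num)) (Nat.mod_lt _ (by norm_num)) hs)
  obtain ⟨s, hs⟩ := this
  have h₁ := tok_var (L := L) (v := v) (P a) s
  have h₂ := tok_var (L := L) (v := v) (P b) s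
  rw [← hab] at h₂
  have hne' :
      maskValue (P a % 7) (L (P a / 7) s).2 s ≠ maskValue (P b % 7) (L (P a / 7) s).2 s := by
    unfold maskValue
    revert hs
    cases (L (P a / 7) s).2 <;> cases (P a % 7 + 1).testBit s <;>
      cases (P b % 7 + 1).testBit s <;> simp
  refine hm ⟨s, ?_⟩
  revert h₁ h₂ hne'
  cases maskValue (P a % 7) (L (P a / 7) s).2 s <;>
    cases maskValue (P b % 7) (L (P a / 7) s).2 s <;> intro h₁ h₂ hne'
  · exact absurd rfl hne'
  · exact ⟨⟨b, hb, h₂⟩, a, ha, h₁⟩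
  · exact ⟨⟨a, ha, h₁⟩, b, hb, h₂⟩
  · exact absurd rfl hne'

/-- From an unmixed position, the path goes to a neighbouring position. -/
theorem pos_step (h : PathEnum L v n P) (hv : ∀ p a, (L p a).1 < v) {a b : ℕ} (ha : a < n)
    (hb : b < n) (hab : a + 1 = b) (hm : ¬ MixedPos L v n P (P a / 7)) :
    P a / 7 + 1 = P b / 7 ∨ P b / 7 + 1 = P a / 7 := by
  obtain ⟨k, c, h₁, h₂⟩ := (h.clash a ha b hb (by omega)).2 (Or.inl hab)
  have h₁' := h₁
  have h₂' := h₂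
  rcases h₁ with ⟨s, rfl, h₁⟩ | ⟨rfl, h₁⟩ | ⟨rfl, h₁⟩
  · refine absurd ⟨s, ?_⟩ hm
    cases c
    · exact ⟨⟨b, hb, h₂'⟩, a, ha, h₁'⟩
    · exact ⟨⟨a, ha, h₁'⟩, b, hb, h₂'⟩
  · rcases h₂ with ⟨s, h₃, h₂⟩ | ⟨h₃, h₂⟩ | ⟨h₃, h₂⟩
    · have := hv (P b / 7) s; omega
    · simp at h₃
    · omega
  · rcases h₂ with ⟨s, h₃, h₂⟩ | ⟨h₃, h₂⟩ | ⟨h₃, h₂⟩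
    · have := hv (P b / 7) s; omega
    · omega
    · simp at h₃

/-- Along unmixed positions, the path is monotone. -/
theorem run (h : PathEnum L v n P) (hv : ∀ p a, (L p a).1 < v) {a : ℕ} (K : ℕ) (hK : a + K < n)
    (hm : ∀ k < K, ¬ MixedPos L v n P (P (a + k) / 7)) :
    (∀ k ≤ K, P (a + k) / 7 = P a / 7 + k) ∨ ∀ k ≤ K, P (a + k) / 7 + k = P a / 7 := by
  induction K with
  | zero =>
    left
    intro k hk
    obtain rfl : k = 0 := by omega
    rfl
  | succ K ih =>
    have hs := h.pos_step hv (a := a + K) (b := a + (K + 1)) (by omega) hK rfl (hm K (by omega))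
    rcases K with _ | K
    · rcases hs with hs | hs
      · left
        intro k hk
        obtain rfl | rfl : k = 0 ∨ k = 1 := by omega
        · rfl
        · exact hs.symm
      · right
        intro k hk
        obtain rfl | rfl : k = 0 ∨ k = 1 := by omega
        · rfl
        · exact hs
    · have hne : P (a + K) / 7 ≠ P (a + (K + 1 + 1)) / 7 := fun he => by
        have := h.eq_of_pos_eq (a := a + K) (b := a + (K + 1 + 1)) (by omega) hK
          (hm K (by omega)) he
        omega
      rcases ih (by omega) fun k hk => hm k (by omega) with ih | ih
      · left
        have h1 := ih K (by omega)
        have h2 := ih (K + 1) le_rfl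
        intro k hk
        rcases Nat.lt_or_ge k (K + 1 + 1) with hk' | hk'
        · exact ih k (by omega)
        · obtain rfl : k = K + 1 + 1 := by omega
          omega
      · right
        have h1 := ih K (by omega)
        have h2 := ih (K + 1) le_rfl
        intro k hk
        rcases Nat.lt_or_ge k (K + 1 + 1) with hk' | hk'
        · exact ih k (by omega)
        · obtain rfl : k = K + 1 + 1 := by omega
          omega

end PathEnum

theorem card_le_three {s : Finset ℕ} (h : ∀ a ∈ s, ∀ b ∈ s, a ≤ b + 2) : s.card ≤ 3 := by
  rcases s.eq_empty_or_nonempty with rfl | hs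
  · simp
  · have : s ⊆ Finset.Icc (s.min' hs) (s.min' hs + 2) := fun a ha =>
      Finset.mem_Icc.2 ⟨s.min'_le a ha, h a ha _ (s.min'_mem hs)⟩
    have := Finset.card_le_card this
    rw [Nat.card_Icc] at this
    omega

/-- If the literals that the path makes true do not satisfy the clause of position `p₀`, then the
path visits this clause only if it is mixed. -/
theorem mixedPos_of_forall_ne {n p₀ a : ℕ} {P : ℕ → ℕ} (ha : a < n)
    (hp : L (P a / 7) = L p₀) {τ : ℕ → Bool}
    (hτ : ∀ x, τ x = true ↔ ∃ a < n, Tok L v (P a) x true)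
    (hp₀ : ∀ s, τ (L p₀ s).1 ≠ (L p₀ s).2) : MixedPos L v n P (P a / 7) := by
  obtain ⟨s, hs⟩ := exists_testBit (Nat.mod_lt (P a) (show 0 < 7 by norm_num))
  have h₁ := tok_var (L := L) (v := v) (P a) s
  have h₂ := hp₀ s
  refine ⟨s, ?_⟩
  rw [← hp] at h₂
  rw [maskValue, hs] at h₁
  have h₃ := hτ (L (P a / 7) s).1
  cases hb : (L (P a / 7) s).2
  · rw [hb] at h₁ h₂
    rw [ne_eq, Bool.not_eq_false] at h₂
    exact ⟨h₃.1 h₂, a, ha, h₁⟩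
  · rw [hb] at h₁ h₂
    exact absurd (h₃.2 ⟨a, ha, h₁⟩) h₂

namespace PathEnum

variable {n m : ℕ} {P : ℕ → ℕ}

/-- A clause that is not mixed is visited at most seven times. Namely, consider the first mixed
vertex after a visit: the direction of the path determines its clause, and the distance to it, and
each mixed clause is visited at most three times. Only the last visit is not followed by a mixed
vertex, since between two visits, the path runs through all clauses, or through a mixed one. -/
theorem card_visits_le (h : PathEnum L v n P) (hv : ∀ p a, (L p a).1 < v) (hm : 0 < m)
    (hL : ∀ p p', p % m = p' % m → L p = L p') {p₀ : ℕ}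
    (h₀ : ∀ a < n, P a / 7 % m = p₀ % m → MixedPos L v n P (P a / 7))
    {A : Finset ℕ} (hA : ∀ a ∈ A, a < n) (hAA : ∀ a ∈ A, ∀ b ∈ A, P a / 7 % m = P b / 7 % m) :
    A.card ≤ 7 := by
  classical
  by_cases hmix : ∃ a ∈ A, MixedPos L v n P (P a / 7)
  · obtain ⟨a, ha, hmix⟩ := hmix
    refine (card_le_three fun b hb c hc => ?_).trans (by norm_num)
    exact h.le_add_two_of_mixedPos (hA b hb) (hA c hc) (hL _ _ (hAA b hb c hc))
      (hmix.congr (hL _ _ (hAA a ha b hb)))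
  push Not at hmix
  -- visits with a later mixed vertex, in forward and in backward direction, and the other ones
  let A₁ := A.filter fun a => ∃ K, a + K < n ∧ MixedPos L v n P (P (a + K) / 7) ∧
    (∀ k < K, ¬ MixedPos L v n P (P (a + k) / 7)) ∧ ∀ k ≤ K, P (a + k) / 7 = P a / 7 + k
  let A₂ := A.filter fun a => ∃ K, a + K < n ∧ MixedPos L v n P (P (a + K) / 7) ∧
    (∀ k < K, ¬ MixedPos L v n P (P (a + k) / 7)) ∧ ∀ k ≤ K, P (a + k) / 7 + k = P a / 7
  let A₃ := A.filter fun a => ∀ k, a + k < n → ¬ MixedPos L v n P (P (a + k) / 7)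
  have hsub : A ⊆ A₁ ∪ A₂ ∪ A₃ := by
    intro a ha
    by_cases hz : ∃ K, a + K < n ∧ MixedPos L v n P (P (a + K) / 7)
    · have hK := Nat.find_spec hz
      have hmin : ∀ k < Nat.find hz, ¬ MixedPos L v n P (P (a + k) / 7) := fun k hk hk' =>
        Nat.find_min hz hk ⟨by omega, hk'⟩
      rcases h.run hv _ hK.1 hmin with hr | hr
      · exact Finset.mem_union_left _ (Finset.mem_union_left _
          (Finset.mem_filter.2 ⟨ha, _, hK.1, hK.2, hmin, hr⟩))
      · exact Finset.mem_union_left _ (Finset.mem_union_right _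
          (Finset.mem_filter.2 ⟨ha, _, hK.1, hK.2, hmin, hr⟩))
    · push Not at hz
      exact Finset.mem_union_right _ (Finset.mem_filter.2 ⟨ha, hz⟩)
  have h1 : A₁.card ≤ 3 := by
    refine card_le_three fun a ha b hb => ?_
    obtain ⟨ha, K, hK, hKm, hKk, hKp⟩ := Finset.mem_filter.1 ha
    obtain ⟨hb, K', hK', hKm', hKk', hKp'⟩ := Finset.mem_filter.1 hb
    have hpos {k : ℕ} (hk : k ≤ K) (hk' : k ≤ K') :
        P (a + k) / 7 % m = P (b + k) / 7 % m := by
      rw [hKp k hk, hKp' k hk']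
      exact Nat.ModEq.add_right k (hAA a ha b hb)
    have : K = K' := by
      rcases lt_trichotomy K K' with hlt | heq | hlt
      · exact absurd (hKm.congr (hL _ _ (hpos le_rfl hlt.le))) (hKk' K hlt)
      · exact heq
      · exact absurd (hKm'.congr (hL _ _ (hpos hlt.le le_rfl).symm)) (hKk K' hlt)
    subst this
    have := h.le_add_two_of_mixedPos hK hK' (hL _ _ (hpos le_rfl le_rfl)) hKm
    omega
  have h2 : A₂.card ≤ 3 := by
    refine card_le_three fun a ha b hb => ?_
    obtain ⟨ha, K, hK, hKm, hKk, hKp⟩ := Finset.mem_filter.1 ha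
    obtain ⟨hb, K', hK', hKm', hKk', hKp'⟩ := Finset.mem_filter.1 hb
    have hpos {k : ℕ} (hk : k ≤ K) (hk' : k ≤ K') :
        P (a + k) / 7 % m = P (b + k) / 7 % m := by
      have := hAA a ha b hb
      rw [← hKp k hk, ← hKp' k hk'] at this
      exact Nat.ModEq.add_right_cancel' k this
    have : K = K' := by
      rcases lt_trichotomy K K' with hlt | heq | hlt
      · exact absurd (hKm.congr (hL _ _ (hpos le_rfl hlt.le))) (hKk' K hlt)
      · exact heq
      · exact absurd (hKm'.congr (hL _ _ (hpos hlt.le le_rfl).symm)) (hKk K' hlt)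
    subst this
    have := h.le_add_two_of_mixedPos hK hK' (hL _ _ (hpos le_rfl le_rfl)) hKm
    omega
  have h3 : A₃.card ≤ 1 := by
    refine Finset.card_le_one.2 fun a ha b hb => ?_
    have key {a b : ℕ} (ha : a ∈ A₃) (hb : b ∈ A₃) : ¬ a < b := by
      intro hab
      obtain ⟨ha, hak⟩ := Finset.mem_filter.1 ha
      obtain ⟨hb, -⟩ := Finset.mem_filter.1 hb
      have hbn := hA b hb
      obtain ⟨K, rfl⟩ := Nat.exists_eq_add_of_lt hab
      have hr := h.run hv (a := a) (K + 1) (by omega) fun k hk => hak k (by omega)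
      have hmod := hAA a ha _ hb
      have hdvd : m ∣ K + 1 := by
        rcases hr with hr | hr
        · have h4 := hr (K + 1) le_rfl
          rw [← add_assoc] at h4
          rw [h4] at hmod
          have : P a / 7 + 0 ≡ P a / 7 + (K + 1) [MOD m] := hmod
          exact (Nat.modEq_zero_iff_dvd).1 (Nat.ModEq.add_left_cancel' _ this).symm
        · have h4 := hr (K + 1) le_rfl
          rw [← add_assoc] at h4
          rw [← h4] at hmod
          have : P (a + K + 1) / 7 + (K + 1) ≡ P (a + K + 1) / 7 + 0 [MOD m] := hmod
          exact (Nat.modEq_zero_iff_dvd).1 (Nat.ModEq.add_left_cancel' _ this)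
      have hmK := Nat.le_of_dvd (Nat.succ_pos K) hdvd
      -- some vertex in between visits the clause of `p₀`
      have : ∃ k < m, P (a + k) / 7 % m = p₀ % m := by
        have hp₀ := Nat.mod_lt p₀ hm
        have hpa := Nat.mod_lt (P a / 7) hm
        rcases hr with hr | hr
        · refine ⟨(p₀ % m + (m - P a / 7 % m)) % m, Nat.mod_lt _ hm, ?_⟩
          rw [hr _ ((Nat.mod_lt _ hm).le.trans hmK), Nat.add_mod_mod, ← Nat.mod_add_mod]
          have : P a / 7 % m + (p₀ % m + (m - P a / 7 % m)) = p₀ % m + m := by omega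
          rw [this, Nat.add_mod_right, Nat.mod_mod]
        · refine ⟨(P a / 7 % m + (m - p₀ % m)) % m, Nat.mod_lt _ hm, ?_⟩
          have h5 := hr _ ((Nat.mod_lt (P a / 7 % m + (m - p₀ % m)) hm).le.trans hmK)
          have h6 : P (a + (P a / 7 % m + (m - p₀ % m)) % m) / 7 +
              (P a / 7 % m + (m - p₀ % m)) % m ≡
              p₀ + (P a / 7 % m + (m - p₀ % m)) % m [MOD m] := by
            rw [h5]
            unfold Nat.ModEq
            rw [Nat.add_mod_mod, ← Nat.mod_add_mod]
            have : p₀ % m + (P a / 7 % m + (m - p₀ % m)) = P a / 7 % m + m := by omega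
            rw [this, Nat.add_mod_right, Nat.mod_mod]
          exact Nat.ModEq.add_right_cancel' _ h6
      obtain ⟨k, hk, hkp⟩ := this
      exact hak k (by omega) (h₀ (a + k) (by omega) hkp)
    have := key ha hb
    have := key hb ha
    omega
  have := (Finset.card_le_card hsub).trans (Finset.card_union_le _ _)
  have := Finset.card_union_le A₁ A₂
  omega

end PathEnum

/-- A long induced path yields a satisfying assignment. -/
theorem exists_satisfying_of_inducesPath {m T : ℕ} (hv : ∀ p a, (L p a).1 < v) (hm : 0 < m)
    (hL : ∀ p p', p % m = p' % m → L p = L p') {S : Finset (Fin (7 * T))}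
    (hS : InducesPath (clashGraph L v T) S) (hcard : 7 * m < S.card) :
    ∃ τ : ℕ → Bool, ∀ p, ∃ a, τ (L p a).1 = (L p a).2 := by
  classical
  obtain ⟨q, hq, hadj⟩ := hS.exists_enumeration
  let P : ℕ → ℕ := fun a => if h : a < S.card then (q ⟨a, h⟩ : ℕ) else 0
  have hP (a : ℕ) (ha : a < S.card) : P a = q ⟨a, ha⟩ := dif_pos ha
  have h : PathEnum L v S.card P := by
    constructor
    · intro a ha b hb hab
      rw [hP a ha, hP b hb] at hab
      exact congrArg Fin.val (hq (Fin.ext hab))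
    · intro a ha b hb hab
      rw [hP a ha, hP b hb, ← hadj ⟨a, ha⟩ ⟨b, hb⟩]
      refine ⟨fun hc => ⟨fun he => hab (congrArg Fin.val (hq he)), hc⟩, fun hc => hc.2⟩
  refine ⟨fun x => decide (∃ a < S.card, Tok L v (P a) x true), fun p₀ => ?_⟩
  by_contra! hp₀
  have h₀ : ∀ a < S.card, P a / 7 % m = p₀ % m → MixedPos L v S.card P (P a / 7) :=
    fun a ha hap => mixedPos_of_forall_ne ha (hL _ _ hap) (fun x => decide_eq_true_iff) hp₀
  obtain ⟨i, -, hi⟩ := Finset.exists_lt_card_fiber_of_mul_lt_card_of_maps_to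
    (s := Finset.range S.card) (t := Finset.range m) (f := fun a => P a / 7 % m) (n := 7)
    (fun a _ => Finset.mem_range.2 (Nat.mod_lt _ hm)) (by simpa [Nat.mul_comm] using hcard)
  refine absurd (h.card_visits_le hv hm hL h₀ (A := {a ∈ Finset.range S.card | P a / 7 % m = i})
    (fun a ha => ?_) fun a ha b hb => ?_) (by simpa using hi)
  · simpa using (Finset.mem_filter.1 ha).1
  · rw [(Finset.mem_filter.1 ha).2, (Finset.mem_filter.1 hb).2]

end LongPath

/-! ### The matrix written by the program -/

section Correctness

/-- The clauses `cs`, repeated periodically. -/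
def cyclicClauses (cs : List (Fin 3 → ℕ × Bool)) (p : ℕ) : Fin 3 → ℕ × Bool :=
  cs.getD (p % cs.length) fun _ => (0, true)

/-- The record of the vertex `i`. -/
def graphRecord (W v : ℕ) (cs : List (Fin 3 → ℕ × Bool)) (i : ℕ) : List (Bool × Bool) :=
  vertexRecord W (fun a => (cyclicClauses cs (i / 7) a).1)
    (fun a => maskValue (i % 7) (cyclicClauses cs (i / 7) a).2 a) (v + i / 7)

theorem positionRecords_eq (W v : ℕ) (cs : List (Fin 3 → ℕ × Bool)) (p k : ℕ) :
    positionRecords W v cs p k = (List.range' (7 * p) (7 * k)).map (graphRecord W v cs) := by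
  induction k generalizing p with
  | zero => rfl
  | succ k ih =>
    have h : List.range' (7 * p) (7 * (k + 1)) =
        List.range' (7 * p) 7 ++ List.range' (7 * (p + 1)) (7 * k) := by
      rw [mul_add, mul_add, mul_one, add_comm (7 * k) 7, ← List.range'_append_1]
    rw [positionRecords, ih, h, List.map_append]
    congr 1
    rw [List.range'_eq_map_range, List.map_map, clauseRecords]
    refine List.map_congr_left fun e he => ?_
    have he := List.mem_range.1 he
    have h1 : (7 * p + e) / 7 = p := by omega
    have h2 : (7 * p + e) % 7 = e := by omega
    simp only [comp_apply, graphRecord, h1, h2, cyclicClauses]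

theorem rowBits_eq (c : List (Bool × Bool)) (f : ℕ → List (Bool × Bool)) (D : List Bool)
    (i k : ℕ) : rowBits c (D.drop i) ((List.range' i k).map f) = (List.range' i k).map fun j =>
      ((D.drop j).head?.getD true && decide (0 < clashCount c (f j))) := by
  induction k generalizing i with
  | zero => rfl
  | succ k ih => simp only [List.range'_succ, List.map_cons, rowBits, List.tail_drop, ih]

theorem matrixBits_eq (f : ℕ → List (Bool × Bool)) (ds : List (List (Bool × Bool))) (i k : ℕ) :
    matrixBits i ((List.range' i k).map f) ds = (List.range' i k).flatMap fun j =>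
      rowBits (f j) (List.replicate j true ++ [false]) ds := by
  induction k generalizing i with
  | zero => rfl
  | succ k ih => simp only [List.range'_succ, List.map_cons, matrixBits, List.flatMap_cons, ih]

theorem clashCount_map_pos (l : List ℕ) (f g : ℕ → Bool × Bool) :
    0 < clashCount (l.map f) (l.map g) ↔
      ∃ k ∈ l, ((f k).1 = true ∧ (g k).2 = true) ∨ ((f k).2 = true ∧ (g k).1 = true) := by
  induction l with
  | nil => simp [clashCount]
  | cons x l ih =>
    simp only [List.map_cons, clashCount, List.mem_cons, exists_eq_or_imp, ← ih]
    split
    · rename_i h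
      simp only [Bool.or_eq_true, Bool.and_eq_true] at h
      simp [h]
    · rename_i h
      simp only [Bool.or_eq_true, Bool.and_eq_true] at h
      simp [h]

/-- The records of two vertices tell whether they clash. -/
theorem clashCount_graphRecord_pos {v T i j : ℕ} {cs : List (Fin 3 → ℕ × Bool)}
    (hv : ∀ p a, (cyclicClauses cs p a).1 < v) (hi : i < 7 * T) :
    0 < clashCount (graphRecord (v + T + 1) v cs i) (graphRecord (v + T + 1) v cs j) ↔
      Clash (cyclicClauses cs) v i j := by
  have ht (i k : ℕ) : Tok (cyclicClauses cs) v i k true ↔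
      ((decide (k = (cyclicClauses cs (i / 7) 0).1) &&
          maskValue (i % 7) (cyclicClauses cs (i / 7) 0).2 0 ||
        decide (k = (cyclicClauses cs (i / 7) 1).1) &&
          maskValue (i % 7) (cyclicClauses cs (i / 7) 1).2 1 ||
        decide (k = (cyclicClauses cs (i / 7) 2).1) &&
          maskValue (i % 7) (cyclicClauses cs (i / 7) 2).2 2 ||
        decide (k = v + i / 7)) = true) := by
    simp only [Tok, Fin.exists_fin_succ, Bool.or_eq_true, Bool.and_eq_true, decide_eq_true_eq,
      eq_comm (a := k)]
    simp [or_assoc, eq_comm (b := k)]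
  have hf (i k : ℕ) : Tok (cyclicClauses cs) v i k false ↔
      ((decide (k = (cyclicClauses cs (i / 7) 0).1) &&
          !maskValue (i % 7) (cyclicClauses cs (i / 7) 0).2 0 ||
        decide (k = (cyclicClauses cs (i / 7) 1).1) &&
          !maskValue (i % 7) (cyclicClauses cs (i / 7) 1).2 1 ||
        decide (k = (cyclicClauses cs (i / 7) 2).1) &&
          !maskValue (i % 7) (cyclicClauses cs (i / 7) 2).2 2 ||
        decide (k = v + i / 7 + 1)) = true) := by
    simp only [Tok, Fin.exists_fin_succ, Bool.or_eq_true, Bool.and_eq_true, decide_eq_true_eq,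
      eq_comm (a := k)]
    simp [or_assoc, eq_comm (b := k)]
  rw [graphRecord, graphRecord, vertexRecord, vertexRecord, clashCount_map_pos]
  simp only [← ht, ← hf]
  constructor
  · rintro ⟨k, -, h | h⟩
    · exact ⟨k, true, h⟩
    · exact ⟨k, false, h⟩
  · rintro ⟨k, b, h⟩
    refine ⟨k, ?_, ?_⟩
    · rw [List.mem_range]
      rcases h.1 with ⟨a, rfl, -⟩ | ⟨-, rfl⟩ | ⟨-, rfl⟩
      · have := hv (i / 7) a; omega
      · omega
      · omega
    · cases b
      · exact Or.inr h
      · exact Or.inl h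

theorem matrixBits_eq_encodeGraph {v T : ℕ} {cs : List (Fin 3 → ℕ × Bool)}
    (hv : ∀ p a, (cyclicClauses cs p a).1 < v) :
    matrixBits 0 (positionRecords (v + T + 1) v cs 0 T) (positionRecords (v + T + 1) v cs 0 T) =
      encodeGraph (clashGraph (cyclicClauses cs) v T) := by
  classical
  set f := graphRecord (v + T + 1) v cs with hf
  have h1 : encodeGraph (clashGraph (cyclicClauses cs) v T) =
      (List.range (7 * T)).flatMap fun i => (List.range (7 * T)).map fun j =>
        (decide (i ≠ j) && decide (0 < clashCount (f i) (f j))) := by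
    have hr : List.range (7 * T) = (List.finRange (7 * T)).map Fin.val := by
      apply List.ext_getElem <;> simp
    rw [encodeGraph, hr, List.flatMap_map]
    congr 1
    funext i
    rw [List.map_map]
    refine List.map_congr_left fun j _ => ?_
    rw [comp_apply, ← Bool.decide_and, decide_eq_decide, hf, clashCount_graphRecord_pos hv i.2]
    simp only [clashGraph, ne_eq, Fin.ext_iff]
  rw [h1, positionRecords_eq, Nat.mul_zero, matrixBits_eq, List.range_eq_range']
  congr 1
  funext i
  rw [← List.drop_zero (l := List.replicate i true ++ [false]), rowBits_eq]
  refine List.map_congr_left fun j _ => ?_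
  congr 1
  have := head?_drop_unary i j
  rcases h : ((List.replicate i true ++ [false]).drop j).head? with _ | b
  · rw [h] at this
    have : j ≠ i := by simpa using this.symm
    simp [this.symm]
  · rw [h] at this
    cases b
    · have : j = i := by simpa using this.symm
      simp [this]
    · have : j ≠ i := by simpa using this.symm
      simp [this.symm]

end Correctness

/-! ### Growth rates -/

section Growth

theorem eventually_eval_le_two_rpow (p : Polynomial ℕ) {c : ℝ} (hc : 0 < c) :
    ∀ᶠ s : ℕ in atTop, ((p.eval s : ℕ) : ℝ) ≤ (2 : ℝ) ^ (c * s) := by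
  have hc' : 0 < c * Real.log 2 := mul_pos hc (Real.log_pos one_lt_two)
  have h := ((p.map (Nat.castRingHom ℝ)).comp
    (Polynomial.C (c * Real.log 2)⁻¹ * Polynomial.X)).tendsto_div_exp_atTop
  have h2 : Tendsto (fun s : ℕ => c * Real.log 2 * (s : ℝ)) atTop atTop :=
    tendsto_natCast_atTop_atTop.const_mul_atTop hc'
  filter_upwards [(h.comp h2).eventually_lt_const one_pos] with s hs
  have h3 : (p.map (Nat.castRingHom ℝ)).eval (s : ℝ) = ((p.eval s : ℕ) : ℝ) := by
    simp
  rw [comp_apply, Polynomial.eval_comp, Polynomial.eval_mul, Polynomial.eval_C, Polynomial.eval_X,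
    inv_mul_cancel_left₀ hc'.ne', h3, div_lt_one (Real.exp_pos _)] at hs
  rw [Real.rpow_def_of_pos two_pos]
  calc ((p.eval s : ℕ) : ℝ) ≤ Real.exp (c * Real.log 2 * s) := hs.le
    _ = Real.exp (Real.log 2 * (c * s)) := by ring_nf

/-- A polynomial number of summands, each of which is subexponential, have a subexponential sum. -/
theorem isLittleO_logb_sum (p : Polynomial ℕ) (h : ℕ → ℝ)
    (hh : ∀ c > 0, ∃ K, ∀ m : ℕ, h m ≤ c * m + K) :
    (fun s : ℕ => Real.logb 2 ((p.eval s : ℕ) + 1 +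
      ∑ j ∈ Finset.range (s + 1), (2 : ℝ) ^ h j)) =o[atTop] fun s : ℕ => (s : ℝ) := by
  rw [isLittleO_iff]
  intro c hc
  obtain ⟨K, hK⟩ := hh (c / 3) (by positivity)
  filter_upwards [eventually_eval_le_two_rpow (p + 1 + (Polynomial.X + 1)) (c := c / 3)
    (by positivity), tendsto_natCast_atTop_atTop.eventually_ge_atTop (3 / c * |K|)] with s hs hsK
  have hpos (j : ℕ) : 0 < (2 : ℝ) ^ h j := Real.rpow_pos_of_pos two_pos _
  have h1 : 1 ≤ ((p.eval s : ℕ) : ℝ) + 1 + ∑ j ∈ Finset.range (s + 1), (2 : ℝ) ^ h j := by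
    have : 0 ≤ ∑ j ∈ Finset.range (s + 1), (2 : ℝ) ^ h j :=
      Finset.sum_nonneg fun j _ => (hpos j).le
    have : (0 : ℝ) ≤ p.eval s := Nat.cast_nonneg _
    linarith
  have hE : 1 ≤ (2 : ℝ) ^ (c / 3 * s + |K|) :=
    Real.one_le_rpow one_le_two (by positivity)
  have h2 : ∑ j ∈ Finset.range (s + 1), (2 : ℝ) ^ h j ≤ (s + 1) * (2 : ℝ) ^ (c / 3 * s + |K|) := by
    have : ∀ j ∈ Finset.range (s + 1), (2 : ℝ) ^ h j ≤ (2 : ℝ) ^ (c / 3 * s + |K|) := by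
      intro j hj
      have hj : (j : ℝ) ≤ s := by
        have := Finset.mem_range.1 hj
        exact_mod_cast Nat.lt_succ_iff.1 this
      refine Real.rpow_le_rpow_of_exponent_le one_le_two ((hK j).trans ?_)
      have := le_abs_self K
      have : c / 3 * j ≤ c / 3 * s := by gcongr
      linarith
    have := Finset.sum_le_card_nsmul _ _ _ this
    simpa [nsmul_eq_mul] using this
  have h3 : ((p.eval s : ℕ) : ℝ) + 1 + ∑ j ∈ Finset.range (s + 1), (2 : ℝ) ^ h j ≤
      (2 : ℝ) ^ (c * s) := by
    calc ((p.eval s : ℕ) : ℝ) + 1 + ∑ j ∈ Finset.range (s + 1), (2 : ℝ) ^ h j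
        ≤ ((p.eval s : ℕ) + 1) * (2 : ℝ) ^ (c / 3 * s + |K|) +
          (s + 1) * (2 : ℝ) ^ (c / 3 * s + |K|) := by
          gcongr
          exact le_mul_of_one_le_right (by positivity) hE
      _ = ((p + 1 + (Polynomial.X + 1)).eval s : ℕ) * (2 : ℝ) ^ (c / 3 * s + |K|) := by
          simp only [Polynomial.eval_add, Polynomial.eval_one, Polynomial.eval_X]
          push_cast
          ring
      _ ≤ (2 : ℝ) ^ (c / 3 * s) * (2 : ℝ) ^ (c / 3 * s + |K|) := by gcongr
      _ = (2 : ℝ) ^ (c / 3 * s + (c / 3 * s + |K|)) := (Real.rpow_add two_pos _ _).symm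
      _ ≤ (2 : ℝ) ^ (c * s) := by
          refine Real.rpow_le_rpow_of_exponent_le one_le_two ?_
          have : 3 / c * |K| * (c / 3) ≤ s * (c / 3) := by gcongr
          have h4 : 3 / c * |K| * (c / 3) = |K| := by field_simp
          linarith
  rw [Real.norm_of_nonneg (Real.logb_nonneg one_lt_two h1), Real.norm_of_nonneg (by positivity)]
  calc Real.logb 2 _ ≤ Real.logb 2 ((2 : ℝ) ^ (c * s)) :=
        Real.logb_le_logb_of_le one_lt_two (by linarith) h3
    _ = c * s := Real.logb_rpow two_pos (by norm_num)

/-- A bound that holds eventually holds everywhere up to a constant. -/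
theorem exists_forall_le_add {f g : ℕ → ℝ} (h : ∀ᶠ n in atTop, f n ≤ g n) (hg : ∀ n, 0 ≤ g n) :
    ∃ K, 0 ≤ K ∧ ∀ n, f n ≤ g n + K := by
  obtain ⟨N, hN⟩ := eventually_atTop.1 h
  refine ⟨∑ j ∈ Finset.range N, |f j|, Finset.sum_nonneg fun j _ => abs_nonneg _, fun n => ?_⟩
  rcases Nat.lt_or_ge n N with hn | hn
  · have h1 := Finset.single_le_sum (f := fun j => |f j|) (fun j _ => abs_nonneg _)
      (Finset.mem_range.2 hn)
    have h2 := le_abs_self (f n)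
    have := hg n
    linarith
  · have := hN n hn
    have : 0 ≤ ∑ j ∈ Finset.range N, |f j| := Finset.sum_nonneg fun j _ => abs_nonneg _
    linarith

end Growth

/-! ### The number of positions -/

section Positions

variable {r : ℕ → ℝ}

/-- The least number of positions that allows to detect an approximate solution with more than
`7 * m` vertices is polynomially bounded in `m`, although the ratio between the number of vertices
and the approximation ratio is only linear in `m`. -/
theorem exists_numPositions {ε : ℝ} (hε : 0 < ε) (hr_one : ∀ n, 1 ≤ r n)
    (hr_le : ∀ᶠ n : ℕ in atTop, r n ≤ (n : ℝ) ^ (1 - ε))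
    (hr_drop : ∃ C : ℝ, ∀ n, r n ≤ C * r (n + 1)) :
    ∃ (T : ℕ → ℕ) (d N : ℕ) (D : ℝ), 0 < D ∧
      (∀ m, 0 < m → 7 * m * (⌊r (7 * T m)⌋₊ + 1) ≤ T m) ∧
      (∀ m k, 0 < m → 0 < k → k < T m → k < 7 * m * (⌊r (7 * k)⌋₊ + 1)) ∧
      (∀ m, T m ≤ (98 * m) ^ d + N) ∧
      ∀ m : ℕ, ((7 * T m : ℕ) : ℝ) / r (7 * T m) ≤ D * m := by
  obtain ⟨C, hC⟩ := hr_drop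
  have hr_pos (n : ℕ) : 0 < r n := one_pos.trans_le (hr_one n)
  have hC0 : 0 < C := by
    by_contra! h
    have h1 := hC 0
    have h2 := mul_nonpos_of_nonpos_of_nonneg h (hr_pos (0 + 1)).le
    have := hr_pos 0
    linarith
  obtain ⟨d, hd⟩ := exists_nat_gt (1 / ε)
  have hd0 : (0 : ℝ) < d := (by positivity : (0 : ℝ) < 1 / ε).trans hd
  have hdε : 1 / (d : ℝ) ≤ ε := by
    rw [div_le_iff₀ hd0]
    rw [div_lt_iff₀ hε] at hd
    linarith
  obtain ⟨N, hN⟩ := eventually_atTop.1 hr_le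
  have hfloor (n : ℕ) : ((⌊r n⌋₊ : ℝ) + 1) ≤ 2 * r n := by
    have := Nat.floor_le (hr_pos n).le
    have := hr_one n
    linarith
  have hex (m : ℕ) (hm : 0 < m) : 0 < (98 * m) ^ d + N ∧
      7 * m * (⌊r (7 * ((98 * m) ^ d + N))⌋₊ + 1) ≤ (98 * m) ^ d + N := by
    set T := (98 * m) ^ d + N with hT
    have hT0 : 0 < T := by positivity
    refine ⟨hT0, ?_⟩
    have hx : (1 : ℝ) ≤ ((7 * T : ℕ) : ℝ) := by
      have : 1 ≤ 7 * T := by omega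
      exact_mod_cast this
    have hx0 : (0 : ℝ) < ((7 * T : ℕ) : ℝ) := by linarith
    have h1 : r (7 * T) ≤ ((7 * T : ℕ) : ℝ) ^ (1 - 1 / (d : ℝ)) :=
      (hN _ (by omega)).trans (Real.rpow_le_rpow_of_exponent_le hx (by linarith))
    have h2 : (98 * m : ℝ) ≤ ((7 * T : ℕ) : ℝ) ^ (1 / (d : ℝ)) := by
      have h3 : (98 * m : ℝ) ^ (d : ℝ) ≤ ((7 * T : ℕ) : ℝ) := by
        rw [Real.rpow_natCast]
        have : (98 * m) ^ d ≤ 7 * T := by omega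
        exact_mod_cast this
      calc (98 * m : ℝ) = ((98 * m : ℝ) ^ (d : ℝ)) ^ (1 / (d : ℝ)) := by
            rw [← Real.rpow_mul (by positivity), mul_one_div_cancel hd0.ne', Real.rpow_one]
        _ ≤ _ := Real.rpow_le_rpow (by positivity) h3 (by positivity)
    have h4 : (98 * m : ℝ) * r (7 * T) ≤ ((7 * T : ℕ) : ℝ) := by
      calc (98 * m : ℝ) * r (7 * T) ≤ ((7 * T : ℕ) : ℝ) ^ (1 / (d : ℝ)) *
            ((7 * T : ℕ) : ℝ) ^ (1 - 1 / (d : ℝ)) := by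
            gcongr
            exact (hr_pos _).le
        _ = ((7 * T : ℕ) : ℝ) := by
            rw [← Real.rpow_add hx0, add_sub_cancel, Real.rpow_one]
    have h5 : ((7 * m * (⌊r (7 * T)⌋₊ + 1) : ℕ) : ℝ) ≤ T := by
      push_cast at h4 ⊢
      have := mul_le_mul_of_nonneg_left (hfloor (7 * T)) (by positivity : (0 : ℝ) ≤ 7 * m)
      linarith
    exact_mod_cast h5
  have hex' (m : ℕ) (hm : 0 < m) : ∃ T, 0 < T ∧ 7 * m * (⌊r (7 * T)⌋₊ + 1) ≤ T := ⟨_, hex m hm⟩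
  classical
  let T : ℕ → ℕ := fun m => if hm : 0 < m then Nat.find (hex' m hm) else 0
  have hT (m : ℕ) (hm : 0 < m) : T m = Nat.find (hex' m hm) := dif_pos hm
  have hmin (m k : ℕ) (hm : 0 < m) (hk : 0 < k) (hkT : k < T m) :
      k < 7 * m * (⌊r (7 * k)⌋₊ + 1) := by
    rw [hT m hm] at hkT
    by_contra! h
    exact Nat.find_min (hex' m hm) hkT ⟨hk, h⟩
  refine ⟨T, d, N, 98 * C ^ 7 + 7, by positivity, fun m hm => ?_, hmin, fun m => ?_, fun m => ?_⟩
  · rw [hT m hm]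
    exact (Nat.find_spec (hex' m hm)).2
  · rcases Nat.eq_zero_or_pos m with rfl | hm
    · exact Nat.zero_le _
    · rw [hT m hm]
      exact Nat.find_min' _ (hex m hm)
  · rcases Nat.eq_zero_or_pos m with rfl | hm
    · have : T 0 = 0 := dif_neg (lt_irrefl 0)
      simp [this]
    have hm1 : (1 : ℝ) ≤ m := by exact_mod_cast hm
    have hTpos : 0 < T m := by
      rw [hT m hm]
      exact (Nat.find_spec (hex' m hm)).1
    rw [div_le_iff₀ (hr_pos _)]
    obtain ⟨k, hk⟩ : ∃ k, T m = k + 1 := ⟨T m - 1, by omega⟩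
    rw [hk]
    have hdrop (n j : ℕ) : r n ≤ C ^ j * r (n + j) := by
      induction j with
      | zero => simp
      | succ j ih =>
        calc r n ≤ C ^ j * r (n + j) := ih
          _ ≤ C ^ j * (C * r (n + j + 1)) := by gcongr; exact hC _
          _ = C ^ (j + 1) * r (n + (j + 1)) := by rw [add_assoc]; ring
    -- `k = T m - 1` is too small, and `r` does not drop much between `7 * k` and `7 * (k + 1)`
    have hk' : (k : ℝ) ≤ 14 * m * (C ^ 7 * r (7 * (k + 1))) := by
      rcases Nat.eq_zero_or_pos k with rfl | hk0
      · have := hr_pos (7 * (0 + 1))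
        push_cast
        positivity
      · have h1 : (k : ℝ) ≤ ((7 * m * (⌊r (7 * k)⌋₊ + 1) : ℕ) : ℝ) := by
          exact_mod_cast (hmin m k hm hk0 (by omega)).le
        push_cast at h1
        calc (k : ℝ) ≤ 7 * m * (⌊r (7 * k)⌋₊ + 1) := h1
          _ ≤ 7 * m * (2 * r (7 * k)) := by gcongr; exact hfloor _
          _ = 14 * m * r (7 * k) := by ring
          _ ≤ 14 * m * (C ^ 7 * r (7 * (k + 1))) := by gcongr; exact hdrop (7 * k) 7
    have h2 : (1 : ℝ) ≤ m * r (7 * (k + 1)) :=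
      one_le_mul_of_one_le_of_one_le hm1 (hr_one _)
    push_cast
    linarith

end Positions

/-! ### The reduction -/

section Reduction

theorem unaryEncodeNat_eq (n : ℕ) : Computability.unaryEncodeNat n = List.replicate n true := by
  induction n with
  | zero => rfl
  | succ n ih => rw [Computability.unaryEncodeNat, ih, List.replicate_succ]

theorem length_encodeVertexSet {n : ℕ} (S : Finset (Fin n)) :
    (encodeVertexSet S).length = n := by simp [encodeVertexSet]

theorem count_encodeVertexSet {n : ℕ} (S : Finset (Fin n)) :
    (encodeVertexSet S).count true = S.card := by
  have h : S = ((List.finRange n).filter (· ∈ S)).toFinset := by ext; simp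
  conv_rhs => rw [h]
  rw [List.toFinset_card_of_nodup ((List.nodup_finRange n).filter _),
    ← List.countP_eq_length_filter, encodeVertexSet, List.count, List.countP_map]
  congr 1
  funext v
  simp

theorem eval_mono (p : Polynomial ℕ) {a b : ℕ} (h : a ≤ b) : p.eval a ≤ p.eval b := by
  simp only [Polynomial.eval_eq_sum, Polynomial.sum]
  gcongr

namespace ThreeCNF

/-- The clauses of a formula, with variables as natural numbers. -/
def rawClauses (φ : ThreeCNF) : List (Fin 3 → ℕ × Bool) :=
  φ.clauses.map fun c a => ((c a).1, (c a).2)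

variable (φ : ThreeCNF)

theorem encode_eq :
    φ.encode = List.replicate φ.numVars true ++ false :: clausesCode φ.rawClauses := by
  rw [encode, clausesCode, rawClauses, List.flatMap_map]
  rfl

theorem length_rawClauses : φ.rawClauses.length = φ.clauses.length := List.length_map _

theorem lt_numVars_of_mem {c : Fin 3 → ℕ × Bool} (hc : c ∈ φ.rawClauses) (a : Fin 3) :
    (c a).1 < φ.numVars := by
  obtain ⟨c, -, rfl⟩ := List.mem_map.1 hc
  exact (c a).1.2

variable {φ}

theorem cyclicClauses_mem (h : φ.clauses ≠ []) (p : ℕ) :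
    cyclicClauses φ.rawClauses p ∈ φ.rawClauses := by
  have h0 : 0 < φ.rawClauses.length := by
    rw [length_rawClauses]; exact List.length_pos_iff.2 h
  rw [cyclicClauses, List.getD_eq_getElem _ _ (Nat.mod_lt _ h0)]
  exact List.getElem_mem _

theorem satisfiable_iff (h : φ.clauses ≠ []) : φ.Satisfiable ↔ ∃ τ : ℕ → Bool, ∀ p, ∃ a,
    τ (cyclicClauses φ.rawClauses p a).1 = (cyclicClauses φ.rawClauses p a).2 := by
  constructor
  · rintro ⟨τ, hτ⟩
    refine ⟨fun k => if hk : k < φ.numVars then τ ⟨k, hk⟩ else false, fun p => ?_⟩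
    obtain ⟨c, hc, he⟩ := List.mem_map.1 (cyclicClauses_mem h p)
    obtain ⟨a, ha⟩ := hτ c hc
    refine ⟨a, ?_⟩
    rw [← he]
    simpa using ha
  · rintro ⟨τ, hτ⟩
    refine ⟨fun x => τ x, fun c hc => ?_⟩
    obtain ⟨i, hi, rfl⟩ := List.getElem_of_mem hc
    obtain ⟨a, ha⟩ := hτ i
    have hi' : i < φ.rawClauses.length := by rwa [length_rawClauses]
    have : cyclicClauses φ.rawClauses i = fun a => ((φ.clauses[i] a).1.1, (φ.clauses[i] a).2) := by
      rw [cyclicClauses, Nat.mod_eq_of_lt hi', List.getD_eq_getElem _ _ hi']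
      simp [rawClauses]
    rw [this] at ha
    exact ⟨a, ha⟩

theorem satisfiable_of_clauses_eq_nil (h : φ.clauses = []) : φ.Satisfiable :=
  ⟨fun _ => false, fun c hc => by simp [h] at hc⟩

variable (φ)

theorem length_clausesCode_le :
    (clausesCode φ.rawClauses).length ≤ φ.size * (3 * φ.size + 6) := by
  have h (cs : List (Fin 3 → ℕ × Bool)) (hcs : ∀ c ∈ cs, ∀ a, (c a).1 < φ.numVars) :
      (clausesCode cs).length ≤ cs.length * (3 * φ.numVars + 6) := by
    induction cs with
    | nil => simp [clausesCode]
    | cons c cs ih =>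
      have h0 := hcs c (by simp) 0
      have h1 := hcs c (by simp) 1
      have h2 := hcs c (by simp) 2
      have := ih fun c hc => hcs c (by simp [hc])
      rw [length_clausesCode_cons, List.length_cons, Nat.succ_mul]
      omega
  refine (h _ fun c hc => φ.lt_numVars_of_mem hc).trans ?_
  rw [length_rawClauses, size]
  gcongr <;> omega

end ThreeCNF

/-- If `T` is large compared to the approximation ratio, then approximate solutions of Max Induced
Path on the graph of a formula tell whether the formula is satisfiable. -/
theorem lt_card_iff_satisfiable {φ : ThreeCNF} (hφ : φ.clauses ≠ []) {T : ℕ} {ρ : ℝ}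
    (hT : 7 * φ.clauses.length * (⌊ρ⌋₊ + 1) ≤ T) {S : Finset (Fin (7 * T))}
    (hS : IsApproxMaxInducedPath (clashGraph (cyclicClauses φ.rawClauses) φ.numVars T) ρ S) :
    7 * φ.clauses.length < S.card ↔ φ.Satisfiable := by
  have hm : 0 < φ.clauses.length := List.length_pos_iff.2 hφ
  have hv (p : ℕ) (a : Fin 3) : (cyclicClauses φ.rawClauses p a).1 < φ.numVars :=
    φ.lt_numVars_of_mem (ThreeCNF.cyclicClauses_mem hφ p) a
  rw [ThreeCNF.satisfiable_iff hφ]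
  constructor
  · intro h
    refine exists_satisfying_of_inducesPath hv hm (fun p p' hp => ?_) hS.1 h
    rw [cyclicClauses, cyclicClauses, ThreeCNF.length_rawClauses, hp]
  · rintro ⟨τ, hτ⟩
    obtain ⟨S', hcard, hS'⟩ := exists_inducesPath_of_satisfying hv T τ hτ
    have h1 := hS.2 S' hS'
    rw [hcard] at h1
    by_contra! h
    have h2 : ρ < (⌊ρ⌋₊ : ℝ) + 1 := Nat.lt_floor_add_one ρ
    have h3 : (S.card : ℝ) ≤ ((7 * φ.clauses.length : ℕ) : ℝ) := by exact_mod_cast h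
    have h4 : ((7 * φ.clauses.length * (⌊ρ⌋₊ + 1) : ℕ) : ℝ) ≤ T := by exact_mod_cast hT
    have h5 : (0 : ℝ) < ((7 * φ.clauses.length : ℕ) : ℝ) := by exact_mod_cast (by omega)
    have h6 : (T : ℝ) ≤ ((⌊ρ⌋₊ : ℝ) + 1) * S.card := h1.trans (by gcongr)
    rw [Nat.cast_mul] at h4
    push_cast at h3 h4 h5 h6
    have hcard : (T : ℝ) < T := by
      rcases S.card.eq_zero_or_pos with h0 | h0
      · have h7 : (0 : ℝ) < 7 * φ.clauses.length * ((⌊ρ⌋₊ : ℝ) + 1) := by positivity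
        rw [h0, Nat.cast_zero, mul_zero] at h6
        linarith
      · have h0 : (0 : ℝ) < S.card := by exact_mod_cast h0
        calc (T : ℝ) ≤ ρ * S.card := h1
          _ < ((⌊ρ⌋₊ : ℝ) + 1) * S.card := by gcongr
          _ ≤ ((⌊ρ⌋₊ : ℝ) + 1) * (7 * φ.clauses.length) := by gcongr
          _ = 7 * φ.clauses.length * ((⌊ρ⌋₊ : ℝ) + 1) := by ring
          _ ≤ T := h4
    exact lt_irrefl _ hcard

end Reduction

end SubexpApprox

open SubexpApprox in
theorem mainTheorem4 (hETH : SubexpApprox.ETH) (ε : ℝ) (hε : 0 < ε) (r : ℕ → ℝ)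
    (hr_one : ∀ n, 1 ≤ r n)
    (hr_le : ∀ᶠ n : ℕ in atTop, r n ≤ (n : ℝ) ^ (1 - ε))
    (hr_drop : ∃ C : ℝ, ∀ n, r n ≤ C * r (n + 1))
    (hr_poly : SubexpApprox.PolyTimeRatio r) :
    ¬ ∃ (M : SubexpApprox.Machine) (g : ℕ → ℝ),
      (g =o[atTop] fun n : ℕ => (n : ℝ) / r n) ∧
        SubexpApprox.ApproximatesMaxInducedPathInTime M r g := by
  rintro ⟨M, g, hg, hM⟩
  obtain ⟨R⟩ := hr_poly
  obtain ⟨T, d, N, D, hD, hT, hTmin, hTle, hTD⟩ :=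
    exists_numPositions hε hr_one hr_le hr_drop
  have hr_pos (n : ℕ) : 0 < r n := one_pos.trans_le (hr_one n)
  -- the ratio is bounded by a polynomial everywhere
  obtain ⟨K, hK⟩ : ∃ K : ℕ, ∀ n, ⌊r n⌋₊ ≤ n + K := by
    have : ∀ᶠ n : ℕ in atTop, r n ≤ (n : ℝ) := by
      filter_upwards [hr_le, eventually_ge_atTop 1] with n hn hn1
      have hn1 : (1 : ℝ) ≤ n := by exact_mod_cast hn1
      calc r n ≤ (n : ℝ) ^ (1 - ε) := hn
        _ ≤ (n : ℝ) ^ (1 : ℝ) := Real.rpow_le_rpow_of_exponent_le hn1 (by linarith)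
        _ = n := Real.rpow_one _
    obtain ⟨K, -, hK⟩ := exists_forall_le_add this fun n => Nat.cast_nonneg n
    obtain ⟨K', hK'⟩ := exists_nat_ge K
    refine ⟨K', fun n => Nat.floor_le_of_le ?_⟩
    push_cast
    linarith [hK n]
  let F : Bool → Machine := fun b => if b then M else R.toTM2ComputableAux
  have hF (n : ℕ) : (F false).OutputsWithin (List.replicate n true)
      (List.replicate ⌊r n⌋₊ true) (R.time.eval n) := by
    have := R.outputsFun n
    rw [unaryEncodeNat_eq, unaryEncodeNat_eq, List.length_replicate] at this
    exact ⟨this⟩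
  -- polynomial bounds for the number of positions, for all numbers in the computation, and for
  -- the running time without the approximation algorithm
  let pT : Polynomial ℕ := (98 * Polynomial.X) ^ d + (N : Polynomial ℕ)
  let pA : Polynomial ℕ := Polynomial.X + pT + Polynomial.X * (3 * Polynomial.X + 6) +
    R.time.comp (7 * pT) + (7 * pT + (K : Polynomial ℕ))
  let pB : Polynomial ℕ := 20000 * pA ^ 3 + 3 * Polynomial.X +
    5 * (Polynomial.X * (3 * Polynomial.X + 6)) + 11
  have hpA (s : ℕ) : pA.eval s = s + ((98 * s) ^ d + N) + s * (3 * s + 6) +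
      R.time.eval (7 * ((98 * s) ^ d + N)) + (7 * ((98 * s) ^ d + N) + K) := by
    simp [pA, pT]
  have hpB (s : ℕ) : pB.eval s = 20000 * pA.eval s ^ 3 + 3 * s + 5 * (s * (3 * s + 6)) + 11 := by
    simp [pB]
  refine hETH ⟨(Cmd.decideFormula : Cmd Reg F).toMachine .inp .out, _,
    isLittleO_logb_sum pB (fun m => g (7 * T m)) fun c hc => ?_, fun φ => ?_⟩
  · have : ∀ᶠ n : ℕ in atTop, g n ≤ c / D * (n / r n) := by
      filter_upwards [hg.bound (show 0 < c / D by positivity)] with n hn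
      refine (le_abs_self _).trans (hn.trans_eq ?_)
      rw [Real.norm_of_nonneg (div_nonneg (Nat.cast_nonneg _) (hr_pos n).le)]
    obtain ⟨K', -, hK'⟩ := exists_forall_le_add this fun n => by
      have := hr_pos n
      positivity
    refine ⟨K', fun m => (hK' _).trans ?_⟩
    have h1 : c / D * (((7 * T m : ℕ) : ℝ) / r (7 * T m)) ≤ c / D * (D * m) := by
      gcongr
      exact hTD m
    have h2 : c / D * (D * m) = c * m := by field_simp
    linarith
  · have hsum : (0 : ℝ) < ∑ j ∈ Finset.range (φ.size + 1), (2 : ℝ) ^ g (7 * T j) :=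
      Finset.sum_pos (fun j _ => Real.rpow_pos_of_pos two_pos _) (by simp)
    rw [Real.rpow_logb two_pos (by norm_num) (by positivity), φ.encode_eq]
    by_cases hφ : φ.clauses = []
    · have h := (ex_decideFormula_nil (F := F) φ.numVars).outputsWithin
      have hnil : φ.rawClauses = [] := by rw [ThreeCNF.rawClauses, hφ, List.map_nil]
      refine ⟨true, 3 * φ.numVars + 10 + 1,
        by simp [ThreeCNF.satisfiable_of_clauses_eq_nil hφ], ?_, by rw [hnil]; exact h⟩
      have h1 : 3 * φ.numVars + 10 + 1 ≤ pB.eval φ.size := by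
        have : φ.numVars ≤ φ.size := Nat.le_add_right _ _
        rw [hpB]
        omega
      have h1 : ((3 * φ.numVars + 10 + 1 : ℕ) : ℝ) ≤ ((pB.eval φ.size : ℕ) : ℝ) := by
        exact_mod_cast h1
      linarith
    · set m := φ.clauses.length with hm
      have hm0 : 0 < m := List.length_pos_iff.2 hφ
      have hml : φ.rawClauses.length = m := φ.length_rawClauses
      have hms : m ≤ φ.size := Nat.le_add_left _ _
      have hvs : φ.numVars ≤ φ.size := Nat.le_add_right _ _
      have hraw : φ.rawClauses ≠ [] := by
        rw [← List.length_pos_iff, hml]; exact hm0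
      have hv (p : ℕ) (a : Fin 3) : (cyclicClauses φ.rawClauses p a).1 < φ.numVars :=
        φ.lt_numVars_of_mem (ThreeCNF.cyclicClauses_mem hφ p) a
      obtain ⟨S, t, hS, ht, hMS⟩ :=
        hM (7 * T m) (clashGraph (cyclicClauses φ.rawClauses) φ.numVars (T m))
      rw [← matrixBits_eq_encodeGraph hv] at hMS
      have hTs : T m ≤ (98 * φ.size) ^ d + N := (hTle m).trans (by gcongr)
      have hTk (k : ℕ) (hk : k ≤ T m) : 7 * k ≤ 7 * ((98 * φ.size) ^ d + N) := by omega
      have hpAs := hpA φ.size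
      have hcode := φ.length_clausesCode_le
      have h := ex_decideClauses (F := F) (q := fun n => R.time.eval n) (ρ := fun n => ⌊r n⌋₊)
        (A := pA.eval φ.size) hraw (fun c hc => φ.lt_numVars_of_mem hc) hF
        (by rw [hml]; exact hT m hm0) (fun k hk hkT => by rw [hml]; exact hTmin m k hm0 hk hkT)
        hMS (length_encodeVertexSet S) (by omega) (by omega) (by omega)
        (fun k hk => by have := eval_mono R.time (hTk k hk); omega)
        (fun k hk => by have := hK (7 * k); have := hTk k hk; omega)
      rw [hml, count_encodeVertexSet] at h
      have h' := (ex_decideFormula hraw (by rw [hml]; exact h)).outputsWithin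
      refine ⟨_, _, ?_, ?_, h'⟩
      · rw [decide_eq_true_iff]
        exact lt_card_iff_satisfiable hφ (hT m hm0) hS
      · have h1 : t + 20000 * pA.eval φ.size ^ 3 + 2 * φ.numVars +
            5 * (clausesCode φ.rawClauses).length + 10 + 1 ≤ t + pB.eval φ.size := by
          rw [hpB]
          omega
        have h1 : ((t + 20000 * pA.eval φ.size ^ 3 + 2 * φ.numVars +
            5 * (clausesCode φ.rawClauses).length + 10 + 1 : ℕ) : ℝ) ≤
            ((t + pB.eval φ.size : ℕ) : ℝ) := by exact_mod_cast h1
        have h2 : (2 : ℝ) ^ g (7 * T m) ≤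
            ∑ j ∈ Finset.range (φ.size + 1), (2 : ℝ) ^ g (7 * T j) :=
          Finset.single_le_sum (f := fun j => (2 : ℝ) ^ g (7 * T j))
            (fun j _ => (Real.rpow_pos_of_pos two_pos _).le)
            (Finset.mem_range.2 (Nat.lt_succ_of_le hms))
        refine h1.trans ?_
        push_cast
        linarith
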